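/- Notation. Let $(\mathcal M,d)$ be a uniquely geodesic metric space, and let $\gamma_p^q:[0,d(p,q)]\to\mathcal M$ be the geodesic from $p$ to $q$. For $p\ne q$, $p\neq r$ let $\bar\angle_p(q,r)=\arccos\frac{d^2(p,q)+d^2(p,r)-d^2(q,r)}{2d(p,q)d(p,r)}$ and let $\angle_p(q,r)=\lim_{\rho\to0}\sup_{0<t,s<\rho}\bar\angle_p(\gamma_p^q(t),\gamma_p^r(s))$ be the Alexandrov angle. Let $h(\beta;x,\mu)=d(\mu,x)\,d(\mu,\beta)\cos\angle_\mu(x,\beta)$ be the Alexandrov inner product (equal to $0$ if $x=\mu$ or $\beta=\mu$). Let $D_\kappa=\pi/\sqrt\kappa$ if $\kappa>0$ and $D_\kappa=\infty$ otherwise. The curvature of $\mathcal M$ is bounded above by $\kappa$ if every geodesic triangle $\triangle(p,q,r)$ of perimeter less than $2D_\kappa$ has a comparison triangle $\triangle(\bar p,\bar q,\bar r)$ with the same side lengths in the model plane $(M_\kappa^2,d_\kappa)$ of constant curvature $\kappa$ such that $d(x,y)\le d_\kappa(\bar x,\bar y)$ for all $x$ on the side $pq$ and $y$ on the side $pr$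 with comparison points $\bar x,\bar y$. Setting. Let $(X,Y)$ be a random pair in $\mathcal M\times\{0,1\}$ such that the distribution of $X$ has bounded support, $X$ has a unique Fréchet mean $\mu^*=\arg\min_{\mu}\mathbb E\,d^2(X,\mu)$, and, for some $\beta^*\in\mathcal M$, $\mathbb P(Y=1\mid X)=\{1+\exp(-h(\beta^*;X,\mu^*))\}^{-1}$ almost surely. Let $(X_i,Y_i)$, $i\ge1$, be i.i.d. copies of $(X,Y)$, independent of $(X,Y)$. For each sample size $n\geq 1$ let $\hat\mu_n$ be the sample Fréchet mean of $X_1,\dots,X_n$, assumed to exist and to be unique almost surely, and let $\hat\beta_n$ be any measurable function of the sample that almost surely maximizes $$L_n(\beta)=\frac1n\sum_{i=1}^n\bigl\{Y_ih(\beta;X_i,\hat\mu_n)-\log(1+e^{h(\beta;X_i,\hat\mu_n)})\bigr\}$$ over $\beta\in\mathcal M$ (such a maximizer being assumed to exist almost surely). Let $s^*(x)=1$ if $h(\beta^*;x,\mu^*)\ge0$ and $s^*(x)=0$ otherwise (the Bayes classifier), let $\hat s(x)=1$ if $h(\hat\beta_n;x,\hat\mu_n)\ge0$ and $\hat s(x)=0$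 otherwise (the plug-in classifier, assumed to be measurable in the sample and $x$), and let $\mathcal E(s^*,\hat s)=\mathbb P(\hat s(X)\ne Y)-\mathbb P(s^*(X)\ne Y)$ be the excess risk. The function $h(\beta^*;x,\mu)$ is called regular near $\mu^*$ if there are constants $C_1,C_2>0$ and $0<r_1\le r_2$ such that for all $\mu$ with $d(\mu,\mu^*)\le r_2$: 1) $|h(\beta^*;x,\mu)-h(\beta^*;x,\mu^*)|\le C_2\,d(\mu,\mu^*)$ for all $x$ with $d(x,\mu^*)\le r_2$, and 2) $|d(\beta^*,\mu)\cos\angle_\mu(x,\beta^*)-d(\beta^*,\mu^*)\cos\angle_{\mu^*}(x,\beta^*)|\le C_1\,d(\mu,\mu^*)$ for all $x\neq\mu$ with $d(x,\mu^*)=r_1$ (a term with factor $d(\beta^*,\mu)=0$ or $d(\beta^*,\mu^*)=0$ being $0$). Theorem. Let $\mathcal M$ be complete, with curvature bounded above by some $\kappa\in\mathbb R$ and with diameter at most $D_\kappa/2$, and let $h(\beta^*;x,\mu)$ be regular near $\mu^*$. Then, in the above setting, there is a constant $c>0$, not depending on $n$ or on the choice of the estimators, such that for all $n\ge1$ $$\mathcal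 E(s^*,\hat s)\le c\,\bigl(\mathbb E[d^2(\mu^*,\hat\mu_n)]+\mathbb E[d^2(\beta^*,\hat\beta_n)]\bigr)^{1/2},$$ where the right-hand side is $+\infty$ if one of the expectations is infinite. -/

import Mathlib

open MeasureTheory ProbabilityTheory Filter Topology
open scoped ENNReal

noncomputable section

namespace AlexandrovLogit

/-! ### Geodesics -/

/-- `γ`, restricted to `[0, dist p q]`, is a geodesic connecting `p` to `q`. The values of `γ`
outside of this interval play no role. -/
def IsGeodesic {M : Type*} [Dist M] (γ : ℝ → M) (p q : M) : Prop :=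
  γ 0 = p ∧ γ (dist p q) = q ∧
    ∀ s ∈ Set.Icc 0 (dist p q), ∀ t ∈ Set.Icc 0 (dist p q), dist (γ s) (γ t) = |s - t|

/-- Every two points are connected by exactly one geodesic. -/
def IsUniquelyGeodesic (M : Type*) [Dist M] : Prop :=
  ∀ p q : M, (∃ γ : ℝ → M, IsGeodesic γ p q) ∧
    ∀ γ η : ℝ → M, IsGeodesic γ p q → IsGeodesic η p q → Set.EqOn γ η (Set.Icc 0 (dist p q))

open Classical in
/-- The geodesic connecting `p` to `q` (the constant `p` if there is none). -/
def geod {M : Type*} [Dist M] (p q : M) : ℝ → M :=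
  if h : ∃ γ : ℝ → M, IsGeodesic γ p q then h.choose else fun _ => p

/-! ### Reference planes and upper curvature bounds -/

/-- The reference plane of curvature `κ`: the plane `z = 0` if `κ = 0`, the upper sheet of the
hyperboloid if `κ < 0`, the unit sphere if `κ > 0`. -/
structure ModelPlane (κ : ℝ) where
  x : ℝ
  y : ℝ
  z : ℝ
  flat : κ = 0 → z = 0
  hyperbolic : κ < 0 → x ^ 2 + y ^ 2 - z ^ 2 = -1 ∧ 0 < z
  spherical : 0 < κ → x ^ 2 + y ^ 2 + z ^ 2 = 1

/-- The distance of the reference plane: Euclidean, hyperbolic or angular, rescaled so that the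
curvature is `κ`. -/
instance (κ : ℝ) : Dist (ModelPlane κ) where
  dist p q :=
    if κ = 0 then √((p.x - q.x) ^ 2 + (p.y - q.y) ^ 2)
    else if κ < 0 then Real.arcosh (p.z * q.z - p.x * q.x - p.y * q.y) / √(-κ)
    else Real.arccos (p.x * q.x + p.y * q.y + p.z * q.z) / √κ

/-- `D_κ = π / √κ` if `κ > 0`, and `D_κ = ∞` otherwise. -/
def modelDiam (κ : ℝ) : ℝ≥0∞ :=
  if 0 < κ then ENNReal.ofReal (Real.pi / √κ) else ⊤

/-- The (global) curvature of `M` is bounded above by `κ`: each geodesic triangle `p, q, r` of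
perimeter less than `2 D_κ` has a comparison triangle in the reference plane such that points on
the sides `pq` and `pr` are not further apart than their comparison points. The comparison point
of `γ s` is `γ' s`, since both have distance `s` from the first vertex. -/
def CurvatureLE (M : Type*) [MetricSpace M] (κ : ℝ) : Prop :=
  ∀ (p q r : M) (γ η : ℝ → M), IsGeodesic γ p q → IsGeodesic η p r →
    ENNReal.ofReal (dist p q + dist p r + dist q r) < 2 * modelDiam κ →
    ∃ (p' q' r' : ModelPlane κ) (γ' η' : ℝ → ModelPlane κ),
      dist p' q' = dist p q ∧ dist p' r' = dist p r ∧ dist q' r' = dist q r ∧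
      IsGeodesic γ' p' q' ∧ IsGeodesic η' p' r' ∧
      ∀ s ∈ Set.Icc 0 (dist p q), ∀ t ∈ Set.Icc 0 (dist p r),
        dist (γ s) (η t) ≤ dist (γ' s) (η' t)

/-! ### Angles and the Alexandrov inner product -/

/-- The (Euclidean) comparison angle between `q` and `r` at `p`. -/
def comparisonAngle {M : Type*} [Dist M] (p q r : M) : ℝ :=
  Real.arccos ((dist p q ^ 2 + dist p r ^ 2 - dist q r ^ 2) / (2 * dist p q * dist p r))

/-- The Alexandrov angle between `γ` and `η` emanating from `p`: the upper limit, as `t` and `s`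
decrease to `0` independently, of the comparison angle between `γ t` and `η s` at `p`. -/
def alexandrovAngle {M : Type*} [Dist M] (p : M) (γ η : ℝ → M) : ℝ :=
  limsup (fun ts : ℝ × ℝ => comparisonAngle p (γ ts.1) (η ts.2)) (𝓝[>] 0 ×ˢ 𝓝[>] 0)

/-- The angle at `p` between the geodesics from `p` to `q` and from `p` to `r`; meaningful
for `q ≠ p` and `r ≠ p`. -/
def angleAt {M : Type*} [Dist M] (p q r : M) : ℝ :=
  alexandrovAngle p (geod p q) (geod p r)

/-- The Alexandrov inner product `h(β; x, μ) = d(μ, x) d(μ, β) cos ∠_μ(x, β)`, which is `0` if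
`x = μ` or `β = μ`. -/
def innerAt {M : Type*} [Dist M] (β x μ : M) : ℝ :=
  dist μ x * dist μ β * Real.cos (angleAt μ x β)

/-- `h(β; x, μ)` is regular near `m` (as a function of `μ`). -/
def IsRegularNear {M : Type*} [MetricSpace M] (β m : M) : Prop :=
  ∃ C₁ C₂ r₁ r₂ : ℝ, 0 < C₁ ∧ 0 < C₂ ∧ 0 < r₁ ∧ r₁ ≤ r₂ ∧
    ∀ μ ∈ Metric.closedBall m r₂,
      (∀ x ∈ Metric.closedBall m r₂,
        |innerAt β x μ - innerAt β x m| ≤ C₂ * dist μ m) ∧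
      ∀ x : M, dist x m = r₁ → x ≠ μ →
        |dist β μ * Real.cos (angleAt μ x β) - dist β m * Real.cos (angleAt m x β)|
          ≤ C₁ * dist μ m

/-! ### Regression model, estimators and classifiers -/

/-- `m` is the unique Fréchet mean of the random element `X`. -/
def IsFrechetMean {Ω M : Type*} [MeasurableSpace Ω] [MetricSpace M] (P : Measure Ω)
    (X : Ω → M) (m : M) : Prop :=
  ∀ m' : M, m' ≠ m → ∫ ω, dist (X ω) m ^ 2 ∂P < ∫ ω, dist (X ω) m' ^ 2 ∂P

/-- `m` is the unique sample Fréchet mean of the points `x 0, …, x (n - 1)`. -/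
def IsSampleFrechetMean {M : Type*} [MetricSpace M] {n : ℕ} (x : Fin n → M) (m : M) : Prop :=
  ∀ m' : M, m' ≠ m →
    (n : ℝ)⁻¹ * ∑ i, dist (x i) m ^ 2 < (n : ℝ)⁻¹ * ∑ i, dist (x i) m' ^ 2

/-- The empirical log-likelihood of `β`, with `μ` plugged in for the Fréchet mean. -/
def logLik {M : Type*} [MetricSpace M] {n : ℕ} (z : Fin n → M × Fin 2) (μ β : M) : ℝ :=
  (n : ℝ)⁻¹ * ∑ i, ((((z i).2 : ℕ) : ℝ) * innerAt β (z i).1 μ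
    - Real.log (1 + Real.exp (innerAt β (z i).1 μ)))

/-- The logistic model: `P(Y = 1 ∣ X) = 1 / (1 + exp (-h(β; X, μ)))` almost surely. -/
def IsLogisticModel {Ω M : Type*} [MeasurableSpace Ω] [MetricSpace M] [MeasurableSpace M]
    (P : Measure Ω) (X : Ω → M) (Y : Ω → Fin 2) (β μ : M) : Prop :=
  P⟦{ω | Y ω = 1} | MeasurableSpace.comap X inferInstance⟧
    =ᵐ[P] fun ω => (1 + Real.exp (-innerAt β (X ω) μ))⁻¹

open Classical in
/-- The classifier with parameters `β` and `μ`: class `1` if `h(β; x, μ) ≥ 0`, that is, if the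
success probability at `x` is at least `1 / 2`, and class `0` otherwise. -/
def classifier {M : Type*} [MetricSpace M] (β μ x : M) : Fin 2 :=
  if 0 ≤ innerAt β x μ then 1 else 0

/-- The excess risk `P(s(X) ≠ Y) - P(s₀(X) ≠ Y)` of a (possibly random) classifier `s` over
`s₀`. -/
def excessRisk {Ω M : Type*} [MeasurableSpace Ω] (P : Measure Ω) (X : Ω → M) (Y : Ω → Fin 2)
    (s₀ : M → Fin 2) (s : Ω → M → Fin 2) : ℝ :=
  P.real {ω | s ω (X ω) ≠ Y ω} - P.real {ω | s₀ (X ω) ≠ Y ω}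

end AlexandrovLogit

end

open AlexandrovLogit

/-!
In a reference plane with generalized sine `sn`, the half-angle formula expresses
`sn a * sn b * sin² (θ / 2)`, where `θ` is the angle between the sides `a` and `b` of a triangle,
through the lengths of the sides. Under the upper curvature bound, `sin² (θ / 2)` for the
comparison angle `θ` therefore decreases as two points move along geodesics towards their common
origin. Its limit does not depend on the curvature of the reference plane, so that Alexandrov
angles are limits and are bounded by the comparison angles of hinges.

Angles at a point satisfy the triangle inequality, hence directions scaled by distances form a
metric cone, and the hinge comparison shows that this cone distance is at most a constant times
the distance in `M` (the hypothesis on the diameter keeps `sn` away from its second zero). This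
makes `β ↦ h(β; x, μ)` Lipschitz. Moving `x` along the geodesic through the sphere of radius `r₁`
turns regularity on that sphere into a Lipschitz bound in `μ` for all `x` in a bounded set.

The plug-in and the Bayes classifier disagree only where `|h|` is at most the change of `h` caused
by the estimators, and the conditional excess error `|1 - 2 p|` of a logistic probability `p` is
at most `|h|`. Given the sample the excess risk is thus Lipschitz in the estimation errors;
integrating over the independent sample and applying Jensen's inequality gives the claim.
-/

namespace AlexandrovLogit

namespace IsGeodesic

variable {M : Type*} [Dist M] {γ : ℝ → M} {p q : M} {s : ℝ}

lemma dist_left (hγ : IsGeodesic γ p q) (hs : s ∈ Set.Icc 0 (dist p q)) : dist p (γ s) = s := by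
  have h := hγ.2.2 0 ⟨le_rfl, hs.1.trans hs.2⟩ s hs
  rwa [hγ.1, zero_sub, abs_neg, abs_of_nonneg hs.1] at h

lemma dist_right (hγ : IsGeodesic γ p q) (hs : s ∈ Set.Icc 0 (dist p q)) :
    dist (γ s) q = dist p q - s := by
  have h := hγ.2.2 s hs (dist p q) ⟨hs.1.trans hs.2, le_rfl⟩
  rwa [hγ.2.1, abs_sub_comm, abs_of_nonneg (sub_nonneg.2 hs.2)] at h

lemma restrict (hγ : IsGeodesic γ p q) (hs : s ∈ Set.Icc 0 (dist p q)) :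
    IsGeodesic γ p (γ s) := by
  rw [IsGeodesic, hγ.dist_left hs]
  exact ⟨hγ.1, rfl, fun u hu v hv =>
    hγ.2.2 u ⟨hu.1, hu.2.trans hs.2⟩ v ⟨hv.1, hv.2.trans hs.2⟩⟩

lemma reverse {M : Type*} [PseudoMetricSpace M] {γ : ℝ → M} {p q : M} (hγ : IsGeodesic γ p q) :
    IsGeodesic (fun s => γ (dist p q - s)) q p := by
  refine ⟨by simpa using hγ.2.1, by simpa [dist_comm q p] using hγ.1, fun s hs t ht => ?_⟩
  rw [dist_comm q p] at hs ht
  rw [hγ.2.2 _ ⟨by linarith [hs.2], by linarith [hs.1]⟩ _ ⟨by linarith [ht.2], by linarith [ht.1]⟩,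
    sub_sub_sub_cancel_left, abs_sub_comm]

lemma continuousOn {M : Type*} [PseudoMetricSpace M] {γ : ℝ → M} {p q : M}
    (hγ : IsGeodesic γ p q) : ContinuousOn γ (Set.Icc 0 (dist p q)) := by
  refine (LipschitzOnWith.of_dist_le_mul (K := 1) fun s hs t ht => ?_).continuousOn
  rw [hγ.2.2 s hs t ht, NNReal.coe_one, one_mul, Real.dist_eq]

end IsGeodesic

lemma IsUniquelyGeodesic.isGeodesic_geod {M : Type*} [Dist M] (hgeo : IsUniquelyGeodesic M)
    (p q : M) : IsGeodesic (geod p q) p q := by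
  rw [geod, dif_pos (hgeo p q).1]
  exact (hgeo p q).1.choose_spec

/-! ### Stewart's theorem in the reference planes -/

/-- The bilinear form `ε (v₀ w₀ + v₁ w₁) + v₂ w₂`, in which the reference plane consists of
unit vectors if `ε = 1` (positive curvature) or `ε = -1` (negative curvature). -/
noncomputable def ambientForm (ε : ℝ) : LinearMap.BilinForm ℝ (Fin 3 → ℝ) :=
  Matrix.toBilin' (Matrix.diagonal ![ε, ε, 1])

lemma ambientForm_apply (ε : ℝ) (v w : Fin 3 → ℝ) :
    ambientForm ε v w = ε * (v 0 * w 0 + v 1 * w 1) + v 2 * w 2 := by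
  simp only [ambientForm, Matrix.toBilin'_apply', Matrix.mulVec_diagonal, dotProduct,
    Fin.sum_univ_three, Matrix.cons_val]
  ring

lemma ambientForm_isSymm (ε : ℝ) : (ambientForm ε).IsSymm :=
  ⟨fun v w => by simp only [ambientForm_apply]; ring⟩

lemma eq_zero_of_ambientForm_one_self {w : Fin 3 → ℝ} (hw : ambientForm 1 w w = 0) : w = 0 := by
  rw [ambientForm_apply] at hw
  ext i
  fin_cases i <;> exact pow_eq_zero_iff two_ne_zero |>.1
    (by simp; nlinarith [sq_nonneg (w 0), sq_nonneg (w 1), sq_nonneg (w 2)])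

lemma eq_zero_of_ambientForm_neg_one {p w : Fin 3 → ℝ} (hp : ambientForm (-1) p p = 1)
    (hw : ambientForm (-1) w w = 0) (hpw : ambientForm (-1) p w = 0) : w = 0 := by
  rw [ambientForm_apply] at hp hw hpw
  have hz : w 2 ^ 2 = -(w 0 * p 1 - w 1 * p 0) ^ 2 := by
    linear_combination (w 2 * p 2 + w 0 * p 0 + w 1 * p 1) * hpw - w 2 ^ 2 * hp
      - (p 0 ^ 2 + p 1 ^ 2) * hw
  ext i
  fin_cases i <;> exact pow_eq_zero_iff two_ne_zero |>.1 (by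
    simp
    nlinarith [sq_nonneg (w 0), sq_nonneg (w 1), sq_nonneg (w 2),
      sq_nonneg (w 0 * p 1 - w 1 * p 0)])

/-- With `(S, S') = (sin s, cos s)` and `(A, A') = (sin a, cos a)` if `ε = 1`, and with their
hyperbolic counterparts if `ε = -1`, this expresses a point `m` of the geodesic from `p` to `q`
through its endpoints. -/
lemma smul_eq_of_bilinForm {V : Type*} [AddCommGroup V] [Module ℝ V]
    {B : LinearMap.BilinForm ℝ V} (hB : B.IsSymm) {p q m : V} {ε A A' S S' : ℝ}
    (hnondeg : ∀ w, B w w = 0 → B p w = 0 → w = 0)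
    (hp : B p p = 1) (hq : B q q = 1) (hm : B m m = 1)
    (hpq : B p q = A') (hpm : B p m = S') (hqm : B q m = A' * S' + ε * (A * S))
    (hA : A' ^ 2 + ε * A ^ 2 = 1) (hS : S' ^ 2 + ε * S ^ 2 = 1) :
    A • m = (A * S' - A' * S) • p + S • q := by
  have hqp : B q p = A' := (hB.eq p q).symm.trans hpq
  have hmp : B m p = S' := (hB.eq p m).symm.trans hpm
  have hmq : B m q = A' * S' + ε * (A * S) := (hB.eq q m).symm.trans hqm
  refine sub_eq_zero.1 (hnondeg _ ?_ ?_) <;>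
    simp only [map_add, map_sub, map_smul, LinearMap.add_apply, LinearMap.sub_apply,
      LinearMap.smul_apply, smul_eq_mul, hp, hq, hm, hpq, hpm, hqm, hqp, hmp, hmq]
  · linear_combination (-S ^ 2) * hA - A ^ 2 * hS
  · ring

namespace ModelPlane

variable {κ s : ℝ} {p q : ModelPlane κ} {γ : ℝ → ModelPlane κ}

/-- The position vector of a point of the reference plane. -/
def toVec (p : ModelPlane κ) : Fin 3 → ℝ := ![p.x, p.y, p.z]

lemma sq_dist (p q : ModelPlane 0) : dist p q ^ 2 = (p.x - q.x) ^ 2 + (p.y - q.y) ^ 2 := by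
  have h : dist p q = √((p.x - q.x) ^ 2 + (p.y - q.y) ^ 2) := by simp [dist]
  rw [h, Real.sq_sqrt (by positivity)]

lemma sqrt_mul_dist_of_pos (hκ : 0 < κ) (p q : ModelPlane κ) :
    √κ * dist p q = Real.arccos (ambientForm 1 p.toVec q.toVec) := by
  have h : dist p q = Real.arccos (p.x * q.x + p.y * q.y + p.z * q.z) / √κ := by
    simp [dist, hκ.ne', hκ.not_gt]
  rw [h, mul_div_cancel₀ _ (Real.sqrt_pos.2 hκ).ne']
  simp [ambientForm_apply, toVec]

lemma sqrt_mul_dist_of_neg (hκ : κ < 0) (p q : ModelPlane κ) :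
    √(-κ) * dist p q = Real.arcosh (ambientForm (-1) p.toVec q.toVec) := by
  have h : dist p q = Real.arcosh (p.z * q.z - p.x * q.x - p.y * q.y) / √(-κ) := by
    simp [dist, hκ.ne, hκ]
  rw [h, mul_div_cancel₀ _ (Real.sqrt_pos.2 (neg_pos.2 hκ)).ne']
  simp only [ambientForm_apply, toVec, Matrix.cons_val]
  ring_nf

lemma ambientForm_toVec_self_of_pos (hκ : 0 < κ) (p : ModelPlane κ) :
    ambientForm 1 p.toVec p.toVec = 1 := by
  simp only [ambientForm_apply, toVec, Matrix.cons_val]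
  linear_combination p.spherical hκ

lemma ambientForm_toVec_self_of_neg (hκ : κ < 0) (p : ModelPlane κ) :
    ambientForm (-1) p.toVec p.toVec = 1 := by
  simp only [ambientForm_apply, toVec, Matrix.cons_val]
  linear_combination -(p.hyperbolic hκ).1

lemma cos_sqrt_mul_dist (hκ : 0 < κ) (p q : ModelPlane κ) :
    Real.cos (√κ * dist p q) = ambientForm 1 p.toVec q.toVec := by
  have hp := p.spherical hκ
  have hq := q.spherical hκ
  rw [sqrt_mul_dist_of_pos hκ, Real.cos_arccos] <;>
    simp only [ambientForm_apply, toVec, Matrix.cons_val]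
  · nlinarith [sq_nonneg (p.x + q.x), sq_nonneg (p.y + q.y), sq_nonneg (p.z + q.z)]
  · nlinarith [sq_nonneg (p.x - q.x), sq_nonneg (p.y - q.y), sq_nonneg (p.z - q.z)]

lemma one_le_ambientForm_of_neg (hκ : κ < 0) (p q : ModelPlane κ) :
    1 ≤ ambientForm (-1) p.toVec q.toVec := by
  obtain ⟨hp, hp_pos⟩ := p.hyperbolic hκ
  obtain ⟨hq, hq_pos⟩ := q.hyperbolic hκ
  have hsq : (1 + (p.x * q.x + p.y * q.y)) ^ 2 ≤ (p.z * q.z) ^ 2 := by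
    have hz : (p.z * q.z) ^ 2 = (1 + p.x ^ 2 + p.y ^ 2) * (1 + q.x ^ 2 + q.y ^ 2) := by
      rw [mul_pow]; congr 1 <;> linarith
    rw [hz]
    nlinarith [sq_nonneg (p.x - q.x), sq_nonneg (p.y - q.y), sq_nonneg (p.x * q.y - p.y * q.x)]
  have hle := (abs_le_of_sq_le_sq' hsq (by positivity)).2
  simp only [ambientForm_apply, toVec, Matrix.cons_val]
  linarith

lemma cosh_sqrt_mul_dist (hκ : κ < 0) (p q : ModelPlane κ) :
    Real.cosh (√(-κ) * dist p q) = ambientForm (-1) p.toVec q.toVec := by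
  rw [sqrt_mul_dist_of_neg hκ, Real.cosh_arcosh (one_le_ambientForm_of_neg hκ p q)]

lemma dist_nonneg_of_neg (hκ : κ < 0) (p q : ModelPlane κ) : 0 ≤ dist p q := by
  refine nonneg_of_mul_nonneg_right ?_ (Real.sqrt_pos.2 (neg_pos.2 hκ))
  rw [sqrt_mul_dist_of_neg hκ]
  exact Real.arcosh_nonneg (one_le_ambientForm_of_neg hκ p q)

lemma sqrt_mul_dist_le_pi (hκ : 0 < κ) (p q : ModelPlane κ) : √κ * dist p q ≤ Real.pi :=
  (sqrt_mul_dist_of_pos hκ p q).trans_le (Real.arccos_le_pi _)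

lemma mul_sq_dist {p q : ModelPlane 0} {γ : ℝ → ModelPlane 0} (hγ : IsGeodesic γ p q)
    (hs : s ∈ Set.Icc 0 (dist p q)) (r : ModelPlane 0) :
    dist p q * dist (γ s) r ^ 2 =
      (dist p q - s) * dist p r ^ 2 + s * dist q r ^ 2 - dist p q * s * (dist p q - s) := by
  have hpm := sq_dist p (γ s)
  have hmq := sq_dist (γ s) q
  have hpq := sq_dist p q
  rw [hγ.dist_left hs] at hpm
  rw [hγ.dist_right hs] at hmq
  rw [sq_dist (γ s) r, sq_dist p r, sq_dist q r]
  set a := dist p q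
  have hsum : (a * (γ s).x - (a - s) * p.x - s * q.x) ^ 2
      + (a * (γ s).y - (a - s) * p.y - s * q.y) ^ 2 = 0 := by
    linear_combination (-a * (a - s)) * hpm - a * s * hmq + s * (a - s) * hpq
  obtain ⟨hx, hy⟩ := (add_eq_zero_iff_of_nonneg (sq_nonneg _) (sq_nonneg _)).1 hsum
  rw [pow_eq_zero_iff two_ne_zero] at hx hy
  linear_combination 2 * ((γ s).x - r.x) * hx + 2 * ((γ s).y - r.y) * hy + (a - s) * hpm + s * hmq

lemma sin_mul_cos_dist (hκ : 0 < κ) (hγ : IsGeodesic γ p q) (hs : s ∈ Set.Icc 0 (dist p q))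
    (r : ModelPlane κ) :
    Real.sin (√κ * dist p q) * Real.cos (√κ * dist (γ s) r) =
      Real.sin (√κ * (dist p q - s)) * Real.cos (√κ * dist p r) +
        Real.sin (√κ * s) * Real.cos (√κ * dist q r) := by
  have hpm := cos_sqrt_mul_dist hκ p (γ s)
  have hmq := cos_sqrt_mul_dist hκ (γ s) q
  rw [hγ.dist_left hs] at hpm
  rw [hγ.dist_right hs, mul_sub, Real.cos_sub, ← (ambientForm_isSymm 1).eq] at hmq
  have hm := smul_eq_of_bilinForm (ε := 1) (ambientForm_isSymm 1)
    (fun w hw _ => eq_zero_of_ambientForm_one_self hw)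
    (ambientForm_toVec_self_of_pos hκ p) (ambientForm_toVec_self_of_pos hκ q)
    (ambientForm_toVec_self_of_pos hκ (γ s)) (cos_sqrt_mul_dist hκ p q).symm hpm.symm
    (by rw [one_mul]; exact hmq.symm)
    (by rw [one_mul]; exact Real.cos_sq_add_sin_sq _)
    (by rw [one_mul]; exact Real.cos_sq_add_sin_sq _)
  rw [mul_sub, Real.sin_sub]
  simpa only [map_add, map_smul, LinearMap.add_apply, LinearMap.smul_apply, smul_eq_mul,
    ← cos_sqrt_mul_dist hκ] using congrArg (ambientForm 1 · r.toVec) hm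

lemma sinh_mul_cosh_dist (hκ : κ < 0) (hγ : IsGeodesic γ p q) (hs : s ∈ Set.Icc 0 (dist p q))
    (r : ModelPlane κ) :
    Real.sinh (√(-κ) * dist p q) * Real.cosh (√(-κ) * dist (γ s) r) =
      Real.sinh (√(-κ) * (dist p q - s)) * Real.cosh (√(-κ) * dist p r) +
        Real.sinh (√(-κ) * s) * Real.cosh (√(-κ) * dist q r) := by
  have hpm := cosh_sqrt_mul_dist hκ p (γ s)
  have hmq := cosh_sqrt_mul_dist hκ (γ s) q
  rw [hγ.dist_left hs] at hpm
  rw [hγ.dist_right hs, mul_sub, Real.cosh_sub, ← (ambientForm_isSymm (-1)).eq] at hmq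
  have hm := smul_eq_of_bilinForm (ε := -1) (ambientForm_isSymm (-1))
    (fun w => eq_zero_of_ambientForm_neg_one (ambientForm_toVec_self_of_neg hκ p))
    (ambientForm_toVec_self_of_neg hκ p) (ambientForm_toVec_self_of_neg hκ q)
    (ambientForm_toVec_self_of_neg hκ (γ s)) (cosh_sqrt_mul_dist hκ p q).symm hpm.symm
    (by rw [neg_one_mul, ← sub_eq_add_neg]; exact hmq.symm)
    (by rw [neg_one_mul, ← sub_eq_add_neg]; exact Real.cosh_sq_sub_sinh_sq _)
    (by rw [neg_one_mul, ← sub_eq_add_neg]; exact Real.cosh_sq_sub_sinh_sq _)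
  rw [mul_sub, Real.sinh_sub]
  simpa only [map_add, map_smul, LinearMap.add_apply, LinearMap.smul_apply, smul_eq_mul,
    ← cosh_sqrt_mul_dist hκ] using congrArg (ambientForm (-1) · r.toVec) hm

end ModelPlane

/-! ### Hinge comparison -/

/-- The product `sn a * sn b * sin² (θ / 2)` for a triangle of a reference plane with generalized
sine `sn`, where `a` and `b` are two sides, `θ` is the angle between them, and `c` is the third
side; by the half-angle formula it is a function of the sides. -/
noncomputable def halfAngleProd (sn : ℝ → ℝ) (a b c : ℝ) : ℝ :=
  sn ((c + a - b) / 2) * sn ((c + b - a) / 2)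

lemma halfAngleProd_comm (sn : ℝ → ℝ) (a b c : ℝ) :
    halfAngleProd sn a b c = halfAngleProd sn b a c :=
  mul_comm _ _

lemma halfAngleProd_id (a b c : ℝ) : halfAngleProd id a b c = (c ^ 2 - (a - b) ^ 2) / 4 := by
  simp only [halfAngleProd, id]
  ring

lemma halfAngleProd_sin (k a b c : ℝ) :
    halfAngleProd (fun u => Real.sin (k * u)) a b c =
      (Real.cos (k * (a - b)) - Real.cos (k * c)) / 2 := by
  rw [halfAngleProd, show k * (a - b) = k * ((c + a - b) / 2) - k * ((c + b - a) / 2) by ring,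
    show k * c = k * ((c + a - b) / 2) + k * ((c + b - a) / 2) by ring, Real.cos_sub, Real.cos_add]
  ring

lemma halfAngleProd_sinh (k a b c : ℝ) :
    halfAngleProd (fun u => Real.sinh (k * u)) a b c =
      (Real.cosh (k * c) - Real.cosh (k * (a - b))) / 2 := by
  rw [halfAngleProd, show k * (a - b) = k * ((c + a - b) / 2) - k * ((c + b - a) / 2) by ring,
    show k * c = k * ((c + a - b) / 2) + k * ((c + b - a) / 2) by ring, Real.cosh_sub,
    Real.cosh_add]
  ring

/-- Hinge comparison with a reference plane of generalized sine `sn`: the half-angle expression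
`sin² (θ / 2)` of the comparison angle at `p` does not increase when an endpoint of a side of the
triangle `p q r` moves towards `p`. On the distances that occur in `M`, moreover, `sn` increases
and `sn u / u` decreases by at most the factor `K`. -/
structure HingeComparison (M : Type*) [MetricSpace M] (sn : ℝ → ℝ) (K : ℝ) : Prop where
  one_le : 1 ≤ K
  map_zero : sn 0 = 0
  differentiableAt : DifferentiableAt ℝ sn 0
  deriv_pos : 0 < deriv sn 0
  strictMonoOn (p q : M) : StrictMonoOn sn (Set.Icc 0 (dist p q))
  mul_dist_le (p q : M) : ∀ u ∈ Set.Icc 0 (dist p q), sn u * dist p q ≤ K * u * sn (dist p q)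
  hinge (p q r : M) (γ : ℝ → M) : IsGeodesic γ p q → ∀ s ∈ Set.Icc 0 (dist p q),
    halfAngleProd sn s (dist p r) (dist (γ s) r) * sn (dist p q) ≤
      halfAngleProd sn (dist p q) (dist p r) (dist q r) * sn s

section Instances

variable {M : Type*} [MetricSpace M] {κ : ℝ}

lemma CurvatureLE.exists_comparison (hgeo : IsUniquelyGeodesic M) (hcurv : CurvatureLE M κ)
    {p q : M} {γ : ℝ → M} (hγ : IsGeodesic γ p q) (r : M)
    (hper : ENNReal.ofReal (dist p q + dist p r + dist q r) < 2 * modelDiam κ) :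
    ∃ (p' q' r' : ModelPlane κ) (γ' : ℝ → ModelPlane κ), IsGeodesic γ' p' q' ∧
      dist p' q' = dist p q ∧ dist p' r' = dist p r ∧ dist q' r' = dist q r ∧
      ∀ s ∈ Set.Icc 0 (dist p q), dist (γ s) r ≤ dist (γ' s) r' := by
  obtain ⟨η, hη⟩ := (hgeo p r).1
  obtain ⟨p', q', r', γ', η', hpq, hpr, hqr, hγ', hη', hle⟩ := hcurv p q r γ η hγ hη hper
  refine ⟨p', q', r', γ', hγ', hpq, hpr, hqr, fun s hs => ?_⟩
  have h := hle s hs (dist p r) ⟨dist_nonneg, le_rfl⟩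
  rwa [hη.2.1, ← hpr, hη'.2.1] at h

lemma HingeComparison.of_curvatureLE_zero (hgeo : IsUniquelyGeodesic M)
    (hcurv : CurvatureLE M 0) : HingeComparison M id 1 where
  one_le := le_rfl
  map_zero := rfl
  differentiableAt := differentiableAt_id
  deriv_pos := by simp
  strictMonoOn _ _ := strictMono_id.strictMonoOn _
  mul_dist_le _ _ u _ := by simp
  hinge p q r γ hγ s hs := by
    obtain ⟨p', q', r', γ', hγ', hpq, hpr, hqr, hle⟩ :=
      hcurv.exists_comparison hgeo hγ r (by simp [modelDiam, ENNReal.mul_top])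
    have hstewart := ModelPlane.mul_sq_dist hγ' (hpq.symm ▸ hs) r'
    rw [hpq, hpr, hqr] at hstewart
    have hsq : dist p q * dist (γ s) r ^ 2 ≤ dist p q * dist (γ' s) r' ^ 2 := by
      gcongr
      exact hle s hs
    simp only [halfAngleProd_id, id]
    linarith

lemma sinh_mul_le_mul_sinh {u a : ℝ} (hu : u ∈ Set.Icc 0 a) :
    Real.sinh u * a ≤ u * Real.sinh a := by
  have hconvex : ConvexOn ℝ (Set.Ici (0 : ℝ)) Real.sinh := by
    refine MonotoneOn.convexOn_of_deriv (convex_Ici 0) Real.continuous_sinh.continuousOn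
      Real.differentiable_sinh.differentiableOn ?_
    rw [interior_Ici, Real.deriv_sinh]
    exact Real.cosh_strictMonoOn.monotoneOn.mono Set.Ioi_subset_Ici_self
  rcases hu.1.eq_or_lt with rfl | hu0
  · simp
  have ha : 0 < a := hu0.trans_le hu.2
  have hslope := hconvex.secant_mono (a := 0) (x := u) (y := a) Set.self_mem_Ici hu.1 ha.le
    hu0.ne' ha.ne' hu.2
  rw [Real.sinh_zero, sub_zero, sub_zero, sub_zero, sub_zero, div_le_div_iff₀ hu0 ha] at hslope
  rwa [mul_comm u]

lemma HingeComparison.of_curvatureLE_neg (hgeo : IsUniquelyGeodesic M) (hκ : κ < 0)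
    (hcurv : CurvatureLE M κ) : HingeComparison M (fun u => Real.sinh (√(-κ) * u)) 1 := by
  have hk : 0 < √(-κ) := Real.sqrt_pos.2 (neg_pos.2 hκ)
  have hderiv : HasDerivAt (fun u => Real.sinh (√(-κ) * u)) √(-κ) 0 := by
    simpa using ((hasDerivAt_id (0 : ℝ)).const_mul √(-κ)).sinh
  refine ⟨le_rfl, by simp, hderiv.differentiableAt, hderiv.deriv.symm ▸ hk,
    fun _ _ => (Real.sinh_strictMono.comp (strictMono_mul_left_of_pos hk)).strictMonoOn _,
    fun p q u hu => ?_, fun p q r γ hγ s hs => ?_⟩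
  · have h := sinh_mul_le_mul_sinh (u := √(-κ) * u) (a := √(-κ) * dist p q)
      ⟨mul_nonneg hk.le hu.1, mul_le_mul_of_nonneg_left hu.2 hk.le⟩
    exact le_of_mul_le_mul_left (by linarith) hk
  · obtain ⟨p', q', r', γ', hγ', hpq, hpr, hqr, hle⟩ :=
      hcurv.exists_comparison hgeo hγ r (by simp [modelDiam, ENNReal.mul_top, hκ.not_gt])
    have hstewart := ModelPlane.sinh_mul_cosh_dist hκ hγ' (hpq.symm ▸ hs) r'
    rw [hpq, hpr, hqr] at hstewart
    have hcosh : Real.sinh (√(-κ) * dist p q) * Real.cosh (√(-κ) * dist (γ s) r) ≤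
        Real.sinh (√(-κ) * dist p q) * Real.cosh (√(-κ) * dist (γ' s) r') := by
      refine mul_le_mul_of_nonneg_left (Real.cosh_strictMonoOn.monotoneOn ?_ ?_ ?_)
        (Real.sinh_nonneg_iff.2 (by positivity))
      · exact mul_nonneg hk.le dist_nonneg
      · exact mul_nonneg hk.le (ModelPlane.dist_nonneg_of_neg hκ _ _)
      · exact mul_le_mul_of_nonneg_left (hle s hs) hk.le
    simp only [halfAngleProd_sinh]
    rw [mul_sub, Real.sinh_sub] at hstewart
    rw [mul_sub, Real.cosh_sub, mul_sub, Real.cosh_sub]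
    linarith

lemma sqrt_mul_dist_le_pi_div_two (hκ : 0 < κ)
    (hdiam : Metric.ediam (Set.univ : Set M) ≤ modelDiam κ / 2) (p q : M) :
    √κ * dist p q ≤ Real.pi / 2 := by
  have h : edist p q ≤ ENNReal.ofReal (Real.pi / √κ) / 2 := by
    simpa only [modelDiam, if_pos hκ] using
      (Metric.edist_le_ediam_of_mem (Set.mem_univ p) (Set.mem_univ q)).trans hdiam
  rw [← ENNReal.ofReal_ofNat 2, ← ENNReal.ofReal_div_of_pos two_pos,
    edist_le_ofReal (by positivity)] at h
  calc √κ * dist p q ≤ √κ * (Real.pi / √κ / 2) := by gcongr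
    _ = Real.pi / 2 := by rw [mul_div_assoc', mul_div_cancel₀ _ (Real.sqrt_pos.2 hκ).ne']

lemma perimeter_lt_two_mul_modelDiam (hκ : 0 < κ)
    (hdist : ∀ p q : M, √κ * dist p q ≤ Real.pi / 2) (p q r : M) :
    ENNReal.ofReal (dist p q + dist p r + dist q r) < 2 * modelDiam κ := by
  rw [modelDiam, if_pos hκ, ← ENNReal.ofReal_ofNat 2, ← ENNReal.ofReal_mul two_pos.le,
    ENNReal.ofReal_lt_ofReal_iff (by positivity), mul_div_assoc',
    lt_div_iff₀' (Real.sqrt_pos.2 hκ)]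
  linarith [hdist p q, hdist p r, hdist q r, Real.pi_pos]

lemma sin_mul_le_pi_div_two_mul_sin {u a : ℝ} (hu : u ∈ Set.Icc 0 a) (ha : a ≤ Real.pi / 2) :
    Real.sin u * a ≤ Real.pi / 2 * u * Real.sin a := by
  have hjordan : a ≤ Real.pi / 2 * Real.sin a := by
    have h := Real.mul_le_sin (hu.1.trans hu.2) ha
    rw [div_mul_eq_mul_div, div_le_iff₀ Real.pi_pos] at h
    linarith
  calc Real.sin u * a ≤ u * (Real.pi / 2 * Real.sin a) :=
        mul_le_mul (Real.sin_le hu.1) hjordan (hu.1.trans hu.2) hu.1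
    _ = Real.pi / 2 * u * Real.sin a := by ring

lemma HingeComparison.of_curvatureLE_pos (hgeo : IsUniquelyGeodesic M) (hκ : 0 < κ)
    (hcurv : CurvatureLE M κ) (hdist : ∀ p q : M, √κ * dist p q ≤ Real.pi / 2) :
    HingeComparison M (fun u => Real.sin (√κ * u)) (Real.pi / 2) := by
  have hk : 0 < √κ := Real.sqrt_pos.2 hκ
  have hderiv : HasDerivAt (fun u => Real.sin (√κ * u)) √κ 0 := by
    simpa using ((hasDerivAt_id (0 : ℝ)).const_mul √κ).sin
  refine ⟨by linarith [Real.pi_gt_three], by simp, hderiv.differentiableAt,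
    hderiv.deriv.symm ▸ hk, fun p q u hu v hv huv => ?_, fun p q u hu => ?_,
    fun p q r γ hγ s hs => ?_⟩
  · exact Real.sin_lt_sin_of_lt_of_le_pi_div_two
      (by linarith [mul_nonneg hk.le hu.1, Real.pi_pos])
      ((mul_le_mul_of_nonneg_left hv.2 hk.le).trans (hdist p q)) (mul_lt_mul_of_pos_left huv hk)
  · have h := sin_mul_le_pi_div_two_mul_sin (u := √κ * u)
      ⟨mul_nonneg hk.le hu.1, mul_le_mul_of_nonneg_left hu.2 hk.le⟩ (hdist p q)
    exact le_of_mul_le_mul_left (by linarith) hk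
  · obtain ⟨p', q', r', γ', hγ', hpq, hpr, hqr, hle⟩ :=
      hcurv.exists_comparison hgeo hγ r (perimeter_lt_two_mul_modelDiam hκ hdist p q r)
    have hstewart := ModelPlane.sin_mul_cos_dist hκ hγ' (hpq.symm ▸ hs) r'
    rw [hpq, hpr, hqr] at hstewart
    have hcos : Real.sin (√κ * dist p q) * Real.cos (√κ * dist (γ' s) r') ≤
        Real.sin (√κ * dist p q) * Real.cos (√κ * dist (γ s) r) := by
      refine mul_le_mul_of_nonneg_left (Real.cos_le_cos_of_nonneg_of_le_pi (by positivity)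
        (ModelPlane.sqrt_mul_dist_le_pi hκ _ _) ?_)
        (Real.sin_nonneg_of_nonneg_of_le_pi (by positivity) ?_)
      · exact mul_le_mul_of_nonneg_left (hle s hs) hk.le
      · linarith [hdist p q, Real.pi_pos]
    simp only [halfAngleProd_sin]
    rw [mul_sub, Real.sin_sub] at hstewart
    rw [mul_sub, Real.cos_sub, mul_sub, Real.cos_sub]
    linarith

theorem exists_hingeComparison (hgeo : IsUniquelyGeodesic M) (hcurv : CurvatureLE M κ)
    (hdiam : Metric.ediam (Set.univ : Set M) ≤ modelDiam κ / 2) :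
    ∃ sn K, HingeComparison M sn K := by
  rcases lt_trichotomy κ 0 with hκ | rfl | hκ
  · exact ⟨_, _, .of_curvatureLE_neg hgeo hκ hcurv⟩
  · exact ⟨_, _, .of_curvatureLE_zero hgeo hcurv⟩
  · exact ⟨_, _, .of_curvatureLE_pos hgeo hκ hcurv (sqrt_mul_dist_le_pi_div_two hκ hdiam)⟩

end Instances

/-! ### Alexandrov angles -/

lemma comparisonAngle_comm {M : Type*} [PseudoMetricSpace M] (p q r : M) :
    comparisonAngle p q r = comparisonAngle p r q := by
  rw [comparisonAngle, comparisonAngle, add_comm (dist p q ^ 2), dist_comm q, mul_right_comm]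

lemma angleAt_comm {M : Type*} [PseudoMetricSpace M] (p q r : M) :
    angleAt p q r = angleAt p r q := by
  have hswap : (fun ts : ℝ × ℝ => comparisonAngle p (geod p q ts.1) (geod p r ts.2)) =
      (fun ts => comparisonAngle p (geod p r ts.1) (geod p q ts.2)) ∘ Prod.swap :=
    funext fun _ => comparisonAngle_comm _ _ _
  rw [angleAt, angleAt, alexandrovAngle, alexandrovAngle, hswap, limsup, limsup, ← map_map,
    ← prod_comm]

lemma half_dist_add_sub_mem_Icc {M : Type*} [PseudoMetricSpace M] (p x y : M) :
    (dist x y + dist p x - dist p y) / 2 ∈ Set.Icc 0 (min (dist p x) (dist x y)) := by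
  have h₁ := dist_triangle p x y
  have h₂ := dist_triangle_right x y p
  have h₃ := dist_triangle_right p x y
  rw [dist_comm x p, dist_comm y p] at h₂
  exact ⟨by linarith, le_min (by linarith) (by linarith)⟩

lemma Ioc_prod_Ioc_mem_nhdsGT_prod {a b : ℝ} (ha : 0 < a) (hb : 0 < b) :
    Set.Ioc 0 a ×ˢ Set.Ioc 0 b ∈ (𝓝[>] 0 : Filter ℝ) ×ˢ (𝓝[>] 0 : Filter ℝ) :=
  prod_mem_prod (Ioc_mem_nhdsGT ha) (Ioc_mem_nhdsGT hb)

lemma tendsto_sInf_of_monotoneOn_Ioc_prod {f : ℝ × ℝ → ℝ} {a b : ℝ} (ha : 0 < a) (hb : 0 < b)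
    (hf : MonotoneOn f (Set.Ioc 0 a ×ˢ Set.Ioc 0 b))
    (hbdd : BddBelow (f '' Set.Ioc 0 a ×ˢ Set.Ioc 0 b)) :
    Tendsto f (𝓝[>] 0 ×ˢ 𝓝[>] 0) (𝓝 (sInf (f '' Set.Ioc 0 a ×ˢ Set.Ioc 0 b))) := by
  refine tendsto_order.2 ⟨fun c hc => ?_, fun c hc => ?_⟩
  · filter_upwards [Ioc_prod_Ioc_mem_nhdsGT_prod ha hb] with ts hts
    exact hc.trans_le (csInf_le hbdd ⟨ts, hts, rfl⟩)
  · have hne : (f '' Set.Ioc 0 a ×ˢ Set.Ioc 0 b).Nonempty :=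
      ⟨_, (a, b), ⟨⟨ha, le_rfl⟩, hb, le_rfl⟩, rfl⟩
    obtain ⟨_, ⟨ts', hts', rfl⟩, hlt⟩ := exists_lt_of_csInf_lt hne hc
    filter_upwards [Ioc_prod_Ioc_mem_nhdsGT_prod hts'.1.1 hts'.2.1] with ts hts
    exact (hf ⟨⟨hts.1.1, hts.1.2.trans hts'.1.2⟩, hts.2.1, hts.2.2.trans hts'.2.2⟩ hts'
      ⟨hts.1.2, hts.2.2⟩).trans_lt hlt

/-- The expression `sin² (θ / 2)` for the comparison angle `θ`, in a reference plane with
generalized sine `sn`, of two points at distances `ts.1` and `ts.2` from the common starting point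
of the unit speed curves `γ` and `η`. -/
noncomputable def halfAngleRatio {M : Type*} [Dist M] (sn : ℝ → ℝ) (γ η : ℝ → M)
    (ts : ℝ × ℝ) : ℝ :=
  halfAngleProd sn ts.1 ts.2 (dist (γ ts.1) (η ts.2)) / (sn ts.1 * sn ts.2)

section Angles

variable {M : Type*} [MetricSpace M] {sn : ℝ → ℝ} {K : ℝ} {γ η γ' η' : ℝ → M} {p q r : M}

lemma halfAngleRatio_swap (sn : ℝ → ℝ) (γ η : ℝ → M) (ts : ℝ × ℝ) :
    halfAngleRatio sn γ η ts.swap = halfAngleRatio sn η γ ts := by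
  simp only [halfAngleRatio, Prod.fst_swap, Prod.snd_swap]
  rw [halfAngleProd_comm, dist_comm, mul_comm (sn ts.2)]

lemma IsGeodesic.half_dist_add_sub_mem_Icc (hγ : IsGeodesic γ p q) (hη : IsGeodesic η p r)
    {s t : ℝ} (hs : s ∈ Set.Icc 0 (dist p q)) (ht : t ∈ Set.Icc 0 (dist p r)) :
    (dist (γ s) (η t) + s - t) / 2 ∈ Set.Icc 0 s := by
  have h := AlexandrovLogit.half_dist_add_sub_mem_Icc p (γ s) (η t)
  rw [hγ.dist_left hs, hη.dist_left ht] at h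
  exact ⟨h.1, h.2.trans (min_le_left _ _)⟩

lemma halfAngleRatio_id_mem_Icc (hγ : IsGeodesic γ p q) (hη : IsGeodesic η p r) {ts : ℝ × ℝ}
    (hts : ts ∈ Set.Ioc 0 (dist p q) ×ˢ Set.Ioc 0 (dist p r)) :
    halfAngleRatio id γ η ts ∈ Set.Icc 0 1 := by
  obtain ⟨hs, ht⟩ := hts
  have hleft := hγ.half_dist_add_sub_mem_Icc hη ⟨hs.1.le, hs.2⟩ ⟨ht.1.le, ht.2⟩
  have hright := hη.half_dist_add_sub_mem_Icc hγ ⟨ht.1.le, ht.2⟩ ⟨hs.1.le, hs.2⟩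
  rw [dist_comm] at hright
  have hst : 0 < ts.1 * ts.2 := mul_pos hs.1 ht.1
  exact ⟨div_nonneg (mul_nonneg hleft.1 hright.1) hst.le,
    (div_le_one hst).2 (mul_le_mul hleft.2 hright.2 hright.1 hs.1.le)⟩

lemma tendsto_half_dist_add_sub (hγ : IsGeodesic γ p q) (hη : IsGeodesic η p r) (hq : p ≠ q)
    (hr : p ≠ r) :
    Tendsto (fun ts : ℝ × ℝ => (dist (γ ts.1) (η ts.2) + ts.1 - ts.2) / 2)
      (𝓝[>] 0 ×ˢ 𝓝[>] 0) (𝓝 0) := by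
  have hmem : ∀ᶠ ts : ℝ × ℝ in 𝓝[>] 0 ×ˢ 𝓝[>] 0,
      (dist (γ ts.1) (η ts.2) + ts.1 - ts.2) / 2 ∈ Set.Icc 0 ts.1 :=
    eventually_of_mem (Ioc_prod_Ioc_mem_nhdsGT_prod (dist_pos.2 hq) (dist_pos.2 hr))
      fun ts hts => hγ.half_dist_add_sub_mem_Icc hη (Set.Ioc_subset_Icc_self hts.1)
        (Set.Ioc_subset_Icc_self hts.2)
  exact squeeze_zero' (hmem.mono fun _ => And.left) (hmem.mono fun _ => And.right)
    (tendsto_fst.mono_right nhdsWithin_le_nhds)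

/-- Two generalized sines have asymptotically proportional values at `0`, so that all of them
define the same angles. -/
lemma exists_tendsto_one_halfAngleRatio_eq_mul (h₀ : sn 0 = 0) (hsn : DifferentiableAt ℝ sn 0)
    (hderiv : deriv sn 0 ≠ 0) (hγ : IsGeodesic γ p q) (hη : IsGeodesic η p r) (hq : p ≠ q)
    (hr : p ≠ r) :
    ∃ c : ℝ × ℝ → ℝ, Tendsto c (𝓝[>] 0 ×ˢ 𝓝[>] 0) (𝓝 1) ∧
      ∀ ts, halfAngleRatio sn γ η ts = c ts * halfAngleRatio id γ η ts := by
  have hmul (u : ℝ) : sn u = dslope sn 0 u * u := by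
    simpa [h₀, mul_comm] using (sub_smul_dslope sn 0 u).symm
  have hdslope : Tendsto (dslope sn 0) (𝓝 0) (𝓝 (deriv sn 0)) := by
    simpa only [dslope_same] using (continuousAt_dslope_same.2 hsn).tendsto
  have hfst : Tendsto Prod.fst (𝓝[>] (0 : ℝ) ×ˢ 𝓝[>] (0 : ℝ)) (𝓝 0) :=
    tendsto_fst.mono_right nhdsWithin_le_nhds
  have hsnd : Tendsto Prod.snd (𝓝[>] (0 : ℝ) ×ˢ 𝓝[>] (0 : ℝ)) (𝓝 0) :=
    tendsto_snd.mono_right nhdsWithin_le_nhds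
  have hleft := tendsto_half_dist_add_sub hγ hη hq hr
  have hright : Tendsto (fun ts : ℝ × ℝ => (dist (γ ts.1) (η ts.2) + ts.2 - ts.1) / 2)
      (𝓝[>] 0 ×ˢ 𝓝[>] 0) (𝓝 0) := by
    simpa only [Function.comp_def, Prod.fst_swap, Prod.snd_swap, dist_comm] using
      (tendsto_half_dist_add_sub hη hγ hr hq).comp tendsto_prod_swap
  have hlim := ((hdslope.comp hleft).mul (hdslope.comp hright)).div
    ((hdslope.comp hfst).mul (hdslope.comp hsnd)) (mul_ne_zero hderiv hderiv)
  rw [div_self (mul_ne_zero hderiv hderiv)] at hlim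
  refine ⟨_, hlim, fun ts => ?_⟩
  simp only [halfAngleRatio, halfAngleProd, id, hmul ts.1, hmul ts.2,
    hmul ((_ + ts.1 - ts.2) / 2), hmul ((_ + ts.2 - ts.1) / 2), Pi.div_apply, Function.comp_apply]
  rw [mul_mul_mul_comm, mul_mul_mul_comm (dslope sn 0 ts.1), mul_div_mul_comm]

lemma alexandrovAngle_congr (hγ : γ =ᶠ[𝓝[>] 0] γ') (hη : η =ᶠ[𝓝[>] 0] η') :
    alexandrovAngle p γ η = alexandrovAngle p γ' η' := by
  refine limsup_congr ?_
  filter_upwards [Filter.Eventually.prod_mk hγ hη] with ts hts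
  rw [hts.1, hts.2]

lemma cos_alexandrovAngle_of_tendsto (hγ : IsGeodesic γ p q) (hη : IsGeodesic η p r)
    (hq : p ≠ q) (hr : p ≠ r) {l : ℝ}
    (hl : Tendsto (halfAngleRatio id γ η) (𝓝[>] 0 ×ˢ 𝓝[>] 0) (𝓝 l)) :
    Real.cos (alexandrovAngle p γ η) = 1 - 2 * l := by
  have hmem := Ioc_prod_Ioc_mem_nhdsGT_prod (dist_pos.2 hq) (dist_pos.2 hr)
  have hangle : (fun ts => Real.arccos (1 - 2 * halfAngleRatio id γ η ts))
      =ᶠ[𝓝[>] 0 ×ˢ 𝓝[>] 0] fun ts => comparisonAngle p (γ ts.1) (η ts.2) := by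
    refine eventually_of_mem hmem fun ts hts => ?_
    have hs := hts.1.1.ne'
    have ht := hts.2.1.ne'
    simp only [comparisonAngle, hγ.dist_left (Set.Ioc_subset_Icc_self hts.1),
      hη.dist_left (Set.Ioc_subset_Icc_self hts.2), halfAngleRatio, halfAngleProd_id, id]
    congr 1
    field_simp
    ring
  have hl_mem : l ∈ Set.Icc (0 : ℝ) 1 := isClosed_Icc.mem_of_tendsto hl
    (eventually_of_mem hmem fun ts => halfAngleRatio_id_mem_Icc hγ hη)
  have hlim := ((Real.continuous_arccos.tendsto _).comp
    ((hl.const_mul 2).const_sub 1)).congr' hangle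
  rw [alexandrovAngle, hlim.limsup_eq,
    Real.cos_arccos (by linarith [hl_mem.2]) (by linarith [hl_mem.1])]

namespace HingeComparison

lemma pos (H : HingeComparison M sn K) {u : ℝ} (hu : u ∈ Set.Ioc 0 (dist p q)) : 0 < sn u := by
  have h := H.strictMonoOn p q ⟨le_rfl, hu.1.le.trans hu.2⟩ (Set.Ioc_subset_Icc_self hu) hu.1
  rwa [H.map_zero] at h

lemma nonneg (H : HingeComparison M sn K) {u : ℝ} (hu : u ∈ Set.Icc 0 (dist p q)) :
    0 ≤ sn u := by
  have h := (H.strictMonoOn p q).monotoneOn ⟨le_rfl, hu.1.trans hu.2⟩ hu hu.1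
  rwa [H.map_zero] at h

lemma halfAngleRatio_nonneg (H : HingeComparison M sn K) (hγ : IsGeodesic γ p q)
    (hη : IsGeodesic η p r) {s t : ℝ} (hs : s ∈ Set.Icc 0 (dist p q))
    (ht : t ∈ Set.Icc 0 (dist p r)) : 0 ≤ halfAngleRatio sn γ η (s, t) := by
  have hleft := hγ.half_dist_add_sub_mem_Icc hη hs ht
  have hright := hη.half_dist_add_sub_mem_Icc hγ ht hs
  rw [dist_comm] at hright
  exact div_nonneg (mul_nonneg (H.nonneg ⟨hleft.1, hleft.2.trans hs.2⟩)
    (H.nonneg ⟨hright.1, hright.2.trans ht.2⟩)) (mul_nonneg (H.nonneg hs) (H.nonneg ht))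

lemma halfAngleRatio_le_of_le_left (H : HingeComparison M sn K) (hγ : IsGeodesic γ p q)
    (hη : IsGeodesic η p r) {s s' t : ℝ} (hs : 0 < s) (hss' : s ≤ s') (hs' : s' ≤ dist p q)
    (ht : t ∈ Set.Ioc 0 (dist p r)) :
    halfAngleRatio sn γ η (s, t) ≤ halfAngleRatio sn γ η (s', t) := by
  have hdist := hγ.dist_left ⟨hs.le.trans hss', hs'⟩
  have h := H.hinge p (γ s') (η t) γ (hγ.restrict ⟨hs.le.trans hss', hs'⟩) s
    ⟨hs.le, hdist.symm ▸ hss'⟩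
  rw [hdist, hη.dist_left (Set.Ioc_subset_Icc_self ht)] at h
  have hsn_s := H.pos ⟨hs, hss'.trans hs'⟩
  have hsn_s' := H.pos ⟨hs.trans_le hss', hs'⟩
  have hsn_t := H.pos ht
  simp only [halfAngleRatio]
  rw [← div_div, ← div_div]
  gcongr ?_ / _
  rwa [div_le_div_iff₀ hsn_s hsn_s']

lemma monotoneOn_halfAngleRatio (H : HingeComparison M sn K) (hγ : IsGeodesic γ p q)
    (hη : IsGeodesic η p r) :
    MonotoneOn (halfAngleRatio sn γ η) (Set.Ioc 0 (dist p q) ×ˢ Set.Ioc 0 (dist p r)) := by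
  rintro ⟨s, t⟩ ⟨hs, ht⟩ ⟨s', t'⟩ ⟨hs', ht'⟩ ⟨hss', htt'⟩
  calc halfAngleRatio sn γ η (s, t)
    _ ≤ halfAngleRatio sn γ η (s', t) := H.halfAngleRatio_le_of_le_left hγ hη hs.1 hss' hs'.2 ht
    _ = halfAngleRatio sn η γ (t, s') := halfAngleRatio_swap sn γ η (t, s')
    _ ≤ halfAngleRatio sn η γ (t', s') :=
      H.halfAngleRatio_le_of_le_left hη hγ ht.1 htt' ht'.2 hs'
    _ = halfAngleRatio sn γ η (s', t') := halfAngleRatio_swap sn η γ (s', t')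

lemma bddBelow_halfAngleRatio (H : HingeComparison M sn K) (hγ : IsGeodesic γ p q)
    (hη : IsGeodesic η p r) :
    BddBelow (halfAngleRatio sn γ η '' Set.Ioc 0 (dist p q) ×ˢ Set.Ioc 0 (dist p r)) := by
  refine ⟨0, ?_⟩
  rintro _ ⟨ts, hts, rfl⟩
  exact H.halfAngleRatio_nonneg hγ hη (Set.Ioc_subset_Icc_self hts.1)
    (Set.Ioc_subset_Icc_self hts.2)

lemma exists_tendsto_halfAngleRatio (H : HingeComparison M sn K) (hγ : IsGeodesic γ p q)
    (hη : IsGeodesic η p r) (hq : p ≠ q) (hr : p ≠ r) :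
    ∃ l ≤ halfAngleRatio sn γ η (dist p q, dist p r),
      Tendsto (halfAngleRatio id γ η) (𝓝[>] 0 ×ˢ 𝓝[>] 0) (𝓝 l) := by
  have hq' := dist_pos.2 hq
  have hr' := dist_pos.2 hr
  obtain ⟨c, hc, heq⟩ := exists_tendsto_one_halfAngleRatio_eq_mul H.map_zero H.differentiableAt
    H.deriv_pos.ne' hγ hη hq hr
  have hbdd := H.bddBelow_halfAngleRatio hγ hη
  have hlim := (tendsto_sInf_of_monotoneOn_Ioc_prod hq' hr'
    (H.monotoneOn_halfAngleRatio hγ hη) hbdd).div hc one_ne_zero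
  rw [div_one] at hlim
  refine ⟨_, csInf_le hbdd ⟨_, ⟨⟨hq', le_rfl⟩, hr', le_rfl⟩, rfl⟩, hlim.congr' ?_⟩
  filter_upwards [hc.eventually_ne one_ne_zero] with ts hts
  rw [Pi.div_apply, heq, mul_div_cancel_left₀ _ hts]

lemma tendsto_halfAngleRatio_id (H : HingeComparison M sn K) (hγ : IsGeodesic γ p q)
    (hη : IsGeodesic η p r) (hq : p ≠ q) (hr : p ≠ r) :
    Tendsto (halfAngleRatio id γ η) (𝓝[>] 0 ×ˢ 𝓝[>] 0)
      (𝓝 ((1 - Real.cos (alexandrovAngle p γ η)) / 2)) := by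
  obtain ⟨l, -, hl⟩ := H.exists_tendsto_halfAngleRatio hγ hη hq hr
  rw [cos_alexandrovAngle_of_tendsto hγ hη hq hr hl]
  convert hl using 2
  ring

lemma one_sub_cos_alexandrovAngle_div_two_le (H : HingeComparison M sn K)
    (hγ : IsGeodesic γ p q) (hη : IsGeodesic η p r) (hq : p ≠ q) (hr : p ≠ r) :
    (1 - Real.cos (alexandrovAngle p γ η)) / 2 ≤
      halfAngleRatio sn γ η (dist p q, dist p r) := by
  obtain ⟨l, hle, hl⟩ := H.exists_tendsto_halfAngleRatio hγ hη hq hr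
  rw [cos_alexandrovAngle_of_tendsto hγ hη hq hr hl]
  linarith

end HingeComparison

lemma IsUniquelyGeodesic.angleAt_eq_alexandrovAngle (hgeo : IsUniquelyGeodesic M)
    (hγ : IsGeodesic γ p q) (hη : IsGeodesic η p r) (hq : p ≠ q) (hr : p ≠ r) :
    angleAt p q r = alexandrovAngle p γ η := by
  refine alexandrovAngle_congr
    (eventually_of_mem (Ioc_mem_nhdsGT (dist_pos.2 hq)) fun s hs => ?_)
    (eventually_of_mem (Ioc_mem_nhdsGT (dist_pos.2 hr)) fun t ht => ?_)
  · exact (hgeo p q).2 _ _ (hgeo.isGeodesic_geod p q) hγ (Set.Ioc_subset_Icc_self hs)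
  · exact (hgeo p r).2 _ _ (hgeo.isGeodesic_geod p r) hη (Set.Ioc_subset_Icc_self ht)

lemma IsUniquelyGeodesic.angleAt_apply_left (hgeo : IsUniquelyGeodesic M)
    (hγ : IsGeodesic γ p q) {s : ℝ} (hs : s ∈ Set.Ioc 0 (dist p q)) (hr : p ≠ r) :
    angleAt p (γ s) r = angleAt p q r := by
  have hs' := Set.Ioc_subset_Icc_self hs
  have hη := hgeo.isGeodesic_geod p r
  have hγs : p ≠ γ s := dist_pos.1 (hs.1.trans_eq (hγ.dist_left hs').symm)
  rw [hgeo.angleAt_eq_alexandrovAngle (hγ.restrict hs') hη hγs hr,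
    hgeo.angleAt_eq_alexandrovAngle hγ hη (dist_pos.1 (hs.1.trans_le hs.2)) hr]

end Angles

/-! ### The tangent cone -/

/-- The distance between two points of the Euclidean cone over a space of directions, at distances
`A` and `B` from the apex in directions enclosing the angle `θ`. -/
noncomputable def coneDist (A B θ : ℝ) : ℝ := √(A ^ 2 + B ^ 2 - 2 * A * B * Real.cos θ)

lemma coneDist_nonneg (A B θ : ℝ) : 0 ≤ coneDist A B θ :=
  Real.sqrt_nonneg _

lemma coneDist_eq_sqrt (A B θ : ℝ) :
    coneDist A B θ = √((A - B) ^ 2 + 4 * (A * B) * ((1 - Real.cos θ) / 2)) := by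
  rw [coneDist]
  ring_nf

lemma sq_coneDist {A B : ℝ} (hA : 0 ≤ A) (hB : 0 ≤ B) (θ : ℝ) :
    coneDist A B θ ^ 2 = A ^ 2 + B ^ 2 - 2 * A * B * Real.cos θ := by
  refine Real.sq_sqrt ?_
  nlinarith [sq_nonneg (A - B), mul_nonneg hA hB, Real.cos_le_one θ]

lemma coneDist_le_add {A B : ℝ} (hA : 0 ≤ A) (hB : 0 ≤ B) (θ : ℝ) :
    coneDist A B θ ≤ A + B := by
  refine Real.sqrt_le_iff.2 ⟨add_nonneg hA hB, ?_⟩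
  nlinarith [mul_nonneg hA hB, Real.neg_one_le_cos θ]

/-- Let `A → ∞` in the squared inequality: `B cos θ` is, up to sign, the Busemann function of the
direction in which `A` is measured. -/
lemma mul_cos_le_mul_cos_add {a b δ θ φ : ℝ} (ha : 0 ≤ a) (hb : 0 ≤ b) (hδ : 0 ≤ δ)
    (h : ∀ A > 0, coneDist A a θ ≤ coneDist A b φ + δ) :
    b * Real.cos φ ≤ a * Real.cos θ + δ := by
  have hbound (A : ℝ) (hA : 0 < A) :
      2 * A * (b * Real.cos φ - a * Real.cos θ - δ) ≤ (b + δ) ^ 2 := by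
    have hsq := pow_le_pow_left₀ (coneDist_nonneg _ _ _) (h A hA) 2
    rw [add_sq, sq_coneDist hA.le ha, sq_coneDist hA.le hb] at hsq
    nlinarith [mul_le_mul_of_nonneg_left (coneDist_le_add hA.le hb φ) hδ, sq_nonneg a]
  by_contra! hlt
  have hpos : 0 < b * Real.cos φ - a * Real.cos θ - δ := by linarith
  have hA := hbound (((b + δ) ^ 2 + 1) / (2 * (b * Real.cos φ - a * Real.cos θ - δ)))
    (by positivity)
  field_simp at hA
  linarith

/-- The normalized Alexandrov inner product `d(μ, β) cos ∠_μ(x, β)`, that is, `innerAt β x μ`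
divided by `d(μ, x)`. -/
noncomputable def unitInnerAt {M : Type*} [Dist M] (β x μ : M) : ℝ :=
  dist μ β * Real.cos (angleAt μ x β)

lemma innerAt_eq_dist_mul_unitInnerAt {M : Type*} [Dist M] (β x μ : M) :
    innerAt β x μ = dist μ x * unitInnerAt β x μ :=
  mul_assoc _ _ _

lemma abs_unitInnerAt_le {M : Type*} [PseudoMetricSpace M] (β x μ : M) :
    |unitInnerAt β x μ| ≤ dist μ β := by
  rw [unitInnerAt, abs_mul, abs_of_nonneg dist_nonneg]
  exact mul_le_of_le_one_right dist_nonneg (Real.abs_cos_le_one _)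

section TangentCone

variable {M : Type*} [MetricSpace M] {sn : ℝ → ℝ} {K : ℝ} {γ η ζ : ℝ → M} {p q r x : M}

lemma sq_dist_eq_halfAngleRatio_id {s t : ℝ} (hs : s ≠ 0) (ht : t ≠ 0) :
    dist (γ s) (η t) ^ 2 = (s - t) ^ 2 + 4 * (s * t) * halfAngleRatio id γ η (s, t) := by
  simp only [halfAngleRatio, halfAngleProd_id, id]
  field_simp
  ring

namespace HingeComparison

lemma tendsto_dist_div (H : HingeComparison M sn K) (hγ : IsGeodesic γ p q)
    (hη : IsGeodesic η p r) (hq : p ≠ q) (hr : p ≠ r) {A B : ℝ} (hA : 0 < A) (hB : 0 < B) :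
    Tendsto (fun e => dist (γ (A * e)) (η (B * e)) / e) (𝓝[>] 0)
      (𝓝 (coneDist A B (alexandrovAngle p γ η))) := by
  have hscale {C : ℝ} (hC : 0 < C) : Tendsto (fun e => C * e) (𝓝[>] 0) (𝓝[>] 0) :=
    tendsto_iff_comap.2 (comap_mulLeft_nhdsGT_zero hC).ge
  have hlim := (H.tendsto_halfAngleRatio_id hγ hη hq hr).comp ((hscale hA).prodMk (hscale hB))
  rw [coneDist_eq_sqrt]
  refine ((hlim.const_mul (4 * (A * B))).const_add ((A - B) ^ 2)).sqrt.congr' ?_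
  filter_upwards [self_mem_nhdsWithin] with e (he : 0 < e)
  rw [← Real.sqrt_sq (div_nonneg dist_nonneg he.le), div_pow,
    sq_dist_eq_halfAngleRatio_id (mul_pos hA he).ne' (mul_pos hB he).ne', Function.comp_apply]
  congr 1
  field_simp

lemma coneDist_triangle (H : HingeComparison M sn K) (hγ : IsGeodesic γ p q)
    (hη : IsGeodesic η p r) (hζ : IsGeodesic ζ p x) (hq : p ≠ q) (hr : p ≠ r) (hx : p ≠ x)
    {A B C : ℝ} (hA : 0 < A) (hB : 0 < B) (hC : 0 < C) :
    coneDist A C (alexandrovAngle p γ ζ) ≤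
      coneDist A B (alexandrovAngle p γ η) + coneDist B C (alexandrovAngle p η ζ) := by
  refine le_of_tendsto_of_tendsto (H.tendsto_dist_div hγ hζ hq hx hA hC)
    ((H.tendsto_dist_div hγ hη hq hr hA hB).add (H.tendsto_dist_div hη hζ hr hx hB hC)) ?_
  filter_upwards [self_mem_nhdsWithin] with e (he : 0 < e)
  rw [← add_div]
  gcongr
  exact dist_triangle _ _ _

lemma halfAngleProd_dist_mul_le (H : HingeComparison M sn K) (p q r : M) :
    halfAngleProd sn (dist p q) (dist p r) (dist q r) * (dist p q * dist p r) ≤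
      K ^ 2 * halfAngleProd id (dist p q) (dist p r) (dist q r) *
        (sn (dist p q) * sn (dist p r)) := by
  have hK := zero_le_one.trans H.one_le
  have hleft := half_dist_add_sub_mem_Icc p q r
  have hright := half_dist_add_sub_mem_Icc p r q
  rw [dist_comm r q] at hright
  have hleft' : (dist q r + dist p q - dist p r) / 2 ∈ Set.Icc 0 (dist p q) :=
    ⟨hleft.1, hleft.2.trans (min_le_left _ _)⟩
  have hright' : (dist q r + dist p r - dist p q) / 2 ∈ Set.Icc 0 (dist p r) :=
    ⟨hright.1, hright.2.trans (min_le_left _ _)⟩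
  have hmul := mul_le_mul (H.mul_dist_le p q _ hleft') (H.mul_dist_le p r _ hright')
    (mul_nonneg (H.nonneg hright') dist_nonneg)
    (mul_nonneg (mul_nonneg hK hleft'.1) (H.nonneg ⟨dist_nonneg, le_rfl⟩))
  simp only [halfAngleProd, id]
  linarith

lemma coneDist_le_mul_dist (H : HingeComparison M sn K) (hgeo : IsUniquelyGeodesic M)
    (hq : p ≠ q) (hr : p ≠ r) :
    coneDist (dist p q) (dist p r) (angleAt p q r) ≤ K * dist q r := by
  have hK := H.one_le
  have ha := dist_pos.2 hq
  have hb := dist_pos.2 hr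
  have hγ := hgeo.isGeodesic_geod p q
  have hη := hgeo.isGeodesic_geod p r
  have hangle : (1 - Real.cos (angleAt p q r)) / 2 * (dist p q * dist p r) ≤
      K ^ 2 * halfAngleProd id (dist p q) (dist p r) (dist q r) := by
    have hle := H.one_sub_cos_alexandrovAngle_div_two_le hγ hη hq hr
    rw [halfAngleRatio, hγ.2.1, hη.2.1] at hle
    have hsn := mul_pos (H.pos (p := p) (q := q) ⟨ha, le_rfl⟩)
      (H.pos (p := p) (q := r) ⟨hb, le_rfl⟩)
    rw [le_div_iff₀ hsn] at hle
    refine le_of_mul_le_mul_right (le_trans ?_ (H.halfAngleProd_dist_mul_le p q r)) hsn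
    rw [mul_right_comm]
    exact mul_le_mul_of_nonneg_right hle (mul_pos ha hb).le
  rw [coneDist_eq_sqrt]
  refine Real.sqrt_le_iff.2 ⟨by positivity, ?_⟩
  rw [halfAngleProd_id] at hangle
  nlinarith [sq_nonneg (dist p q - dist p r), one_le_pow₀ hK (n := 2)]

lemma unitInnerAt_le_add (H : HingeComparison M sn K) (hgeo : IsUniquelyGeodesic M) (hx : p ≠ x)
    (q r : M) : unitInnerAt r x p ≤ unitInnerAt q x p + K * dist q r := by
  have hK := H.one_le
  have hdist : dist q r ≤ K * dist q r := le_mul_of_one_le_left dist_nonneg hK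
  rcases eq_or_ne p q with rfl | hq
  · have h := (le_abs_self _).trans (abs_unitInnerAt_le r x p)
    simp only [unitInnerAt, dist_self, zero_mul, zero_add] at h ⊢
    exact h.trans hdist
  rcases eq_or_ne p r with rfl | hr
  · have h := (neg_le_abs _).trans (abs_unitInnerAt_le q x p)
    rw [dist_comm] at h
    simp only [unitInnerAt, dist_self, zero_mul] at h ⊢
    linarith
  refine mul_cos_le_mul_cos_add dist_nonneg dist_nonneg (by positivity) fun A hA => ?_
  calc coneDist A (dist p q) (angleAt p x q)
    _ ≤ coneDist A (dist p r) (angleAt p x r) +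
        coneDist (dist p r) (dist p q) (angleAt p r q) :=
      H.coneDist_triangle (hgeo.isGeodesic_geod p x) (hgeo.isGeodesic_geod p r)
        (hgeo.isGeodesic_geod p q) hx hr hq hA (dist_pos.2 hr) (dist_pos.2 hq)
    _ ≤ coneDist A (dist p r) (angleAt p x r) + K * dist q r := by
      rw [dist_comm q r]
      gcongr
      exact H.coneDist_le_mul_dist hgeo hr hq

lemma abs_unitInnerAt_sub_le (H : HingeComparison M sn K) (hgeo : IsUniquelyGeodesic M)
    (hx : p ≠ x) (q r : M) : |unitInnerAt q x p - unitInnerAt r x p| ≤ K * dist q r := by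
  have hqr := H.unitInnerAt_le_add hgeo hx q r
  have hrq := H.unitInnerAt_le_add hgeo hx r q
  rw [dist_comm] at hrq
  exact abs_le.2 ⟨by linarith, by linarith⟩

end HingeComparison

end TangentCone

/-! ### Stability of the Alexandrov inner product -/

lemma innerAt_comm {M : Type*} [PseudoMetricSpace M] (β x μ : M) :
    innerAt β x μ = innerAt x β μ := by
  rw [innerAt, innerAt, angleAt_comm, mul_comm (dist μ x)]

section Stability

variable {M : Type*} [MetricSpace M] {sn : ℝ → ℝ} {K : ℝ} {γ η : ℝ → M} {m μ p q r x y β : M}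

lemma abs_innerAt_sub_innerAt_le (β x μ m : M) :
    |innerAt β x μ - innerAt β x m| ≤
      dist μ x * |unitInnerAt β x μ - unitInnerAt β x m| + dist μ m * dist m β := by
  calc |innerAt β x μ - innerAt β x m|
    _ = |dist μ x * (unitInnerAt β x μ - unitInnerAt β x m) +
          (dist μ x - dist m x) * unitInnerAt β x m| := by
      rw [innerAt_eq_dist_mul_unitInnerAt, innerAt_eq_dist_mul_unitInnerAt]
      ring_nf
    _ ≤ dist μ x * |unitInnerAt β x μ - unitInnerAt β x m| +
          |dist μ x - dist m x| * |unitInnerAt β x m| := by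
      refine (abs_add_le _ _).trans_eq ?_
      rw [abs_mul, abs_mul, abs_of_nonneg (dist_nonneg (x := μ) (y := x))]
    _ ≤ dist μ x * |unitInnerAt β x μ - unitInnerAt β x m| + dist μ m * dist m β := by
      gcongr
      exacts [abs_dist_sub_le μ m x, abs_unitInnerAt_le β x m]

lemma IsUniquelyGeodesic.unitInnerAt_apply (hgeo : IsUniquelyGeodesic M)
    (hγ : IsGeodesic γ p q) {s : ℝ} (hs : s ∈ Set.Ioc 0 (dist p q)) (β : M) :
    unitInnerAt β (γ s) p = unitInnerAt β q p := by
  rcases eq_or_ne p β with rfl | hβ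
  · simp only [unitInnerAt, dist_self, zero_mul]
  · rw [unitInnerAt, unitInnerAt, hgeo.angleAt_apply_left hγ hs hβ]

lemma IsGeodesic.exists_dist_eq (hγ : IsGeodesic γ p q) {m : M} {r : ℝ}
    (hr : r ∈ Set.Icc (dist p m) (dist q m)) :
    ∃ s ∈ Set.Icc 0 (dist p q), dist (γ s) m = r := by
  have hcont : ContinuousOn (fun s => dist (γ s) m) (Set.Icc 0 (dist p q)) :=
    (continuous_id.dist continuous_const).comp_continuousOn hγ.continuousOn
  refine intermediate_value_Icc dist_nonneg hcont ?_
  rwa [hγ.1, hγ.2.1]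

namespace HingeComparison

lemma halfAngleProd_dist_le (H : HingeComparison M sn K) (p q r : M) :
    halfAngleProd sn (dist p q) (dist p r) (dist q r) ≤ sn (dist q r) ^ 2 := by
  have hleft := half_dist_add_sub_mem_Icc p q r
  have hright := half_dist_add_sub_mem_Icc p r q
  rw [dist_comm r q] at hright
  have hle {u : ℝ} (hu : u ∈ Set.Icc 0 (dist q r)) : sn u ≤ sn (dist q r) :=
    (H.strictMonoOn q r).monotoneOn hu ⟨dist_nonneg, le_rfl⟩ hu.2
  have hright' : (dist q r + dist p r - dist p q) / 2 ∈ Set.Icc 0 (dist q r) :=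
    ⟨hright.1, hright.2.trans (min_le_right _ _)⟩
  rw [halfAngleProd, sq]
  exact mul_le_mul (hle ⟨hleft.1, hleft.2.trans (min_le_right _ _)⟩) (hle hright')
    (H.nonneg hright') (H.nonneg ⟨dist_nonneg, le_rfl⟩)

lemma sq_half_dist_le (H : HingeComparison M sn K) (hγ : IsGeodesic γ x p)
    (hη : IsGeodesic η x q) {s : ℝ} (hs : 0 < s) (hsp : s ≤ dist x p) (hsq : s ≤ dist x q) :
    sn (dist (γ s) (η s) / 2) ^ 2 ≤ sn (dist p q) ^ 2 := by
  have hp : dist x p ∈ Set.Ioc 0 (dist x p) := ⟨hs.trans_le hsp, le_rfl⟩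
  have hq : dist x q ∈ Set.Ioc 0 (dist x q) := ⟨hs.trans_le hsq, le_rfl⟩
  have hsn := H.pos ⟨hs, hsp⟩
  have hsn_le : sn s ^ 2 ≤ sn (dist x p) * sn (dist x q) := by
    rw [sq]
    exact mul_le_mul
      ((H.strictMonoOn x p).monotoneOn ⟨hs.le, hsp⟩ ⟨dist_nonneg, le_rfl⟩ hsp)
      ((H.strictMonoOn x q).monotoneOn ⟨hs.le, hsq⟩ ⟨dist_nonneg, le_rfl⟩ hsq)
      hsn.le (H.pos hp).le
  have hratio := H.monotoneOn_halfAngleRatio hγ hη (a := (s, s)) (b := (dist x p, dist x q))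
    ⟨⟨hs, hsp⟩, hs, hsq⟩ ⟨hp, hq⟩ ⟨hsp, hsq⟩
  simp only [halfAngleRatio, hγ.2.1, hη.2.1] at hratio
  refine (div_le_div_iff_of_pos_right (pow_pos hsn 2)).1 ?_
  calc sn (dist (γ s) (η s) / 2) ^ 2 / sn s ^ 2
    _ = halfAngleProd sn s s (dist (γ s) (η s)) / (sn s * sn s) := by
      rw [halfAngleProd, add_sub_cancel_right, ← sq, ← sq]
    _ ≤ halfAngleProd sn (dist x p) (dist x q) (dist p q) / (sn (dist x p) * sn (dist x q)) :=
      hratio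
    _ ≤ sn (dist p q) ^ 2 / sn s ^ 2 := by
      gcongr
      exact H.halfAngleProd_dist_le x p q

lemma dist_le_two_mul (H : HingeComparison M sn K) (hγ : IsGeodesic γ x p)
    (hη : IsGeodesic η x q) {s : ℝ} (hs : 0 ≤ s) (hsp : s ≤ dist x p) (hsq : s ≤ dist x q) :
    dist (γ s) (η s) ≤ 2 * dist p q := by
  rcases hs.eq_or_lt with rfl | hs
  · rw [hγ.1, hη.1, dist_self]
    positivity
  by_contra! hlt
  have hhalf : dist p q < dist (γ s) (η s) / 2 := by linarith
  have hsn_lt := H.strictMonoOn (γ s) (η s)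
    ⟨dist_nonneg, hhalf.le.trans (half_le_self dist_nonneg)⟩
    ⟨by positivity, half_le_self dist_nonneg⟩ hhalf
  exact (H.sq_half_dist_le hγ hη hs hsp hsq).not_gt
    (pow_lt_pow_left₀ hsn_lt (H.nonneg ⟨dist_nonneg, le_rfl⟩) two_ne_zero)

lemma dist_apply_le_four_mul (H : HingeComparison M sn K) (hγ : IsGeodesic γ μ x)
    (hη : IsGeodesic η m x) {s : ℝ} (hs : s ∈ Set.Icc 0 (dist μ x))
    (hnear : 2 * dist μ m ≤ dist m (γ s)) (hfar : dist m (γ s) ≤ dist m x) :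
    dist (γ s) (η (dist m (γ s))) ≤ 4 * dist μ m := by
  set y := γ s
  have hy_mem : dist m y ∈ Set.Icc 0 (dist m x) := ⟨dist_nonneg, hfar⟩
  have hyx : dist y x = dist μ x - s := hγ.dist_right hs
  have hμy : dist μ y = s := hγ.dist_left hs
  have hle : dist y x ≤ dist m x := by
    linarith [dist_triangle m μ y, dist_triangle μ m x, dist_comm m μ]
  set t := dist m x - dist y x
  have ht : t ∈ Set.Icc 0 (dist m x) := ⟨sub_nonneg.2 hle, sub_le_self _ dist_nonneg⟩
  have hyt : dist y (η t) ≤ 2 * dist μ m := by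
    have h := H.dist_le_two_mul hγ.reverse hη.reverse (s := dist y x) dist_nonneg
      (by rw [dist_comm x μ, hyx]; linarith [hs.1]) (by rwa [dist_comm x m])
    rwa [show dist μ x - dist y x = s by rw [hyx]; ring] at h
  have hty : dist (η t) (η (dist m y)) ≤ dist y (η t) := by
    have h := abs_dist_sub_le (η t) y m
    rwa [dist_comm (η t) m, hη.dist_left ht, dist_comm y m, ← hη.2.2 t ht _ hy_mem,
      dist_comm (η t) y] at h
  linarith [dist_triangle y (η t) (η (dist m y))]

lemma abs_innerAt_sub_le (H : HingeComparison M sn K) (hgeo : IsUniquelyGeodesic M)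
    (β β' x μ : M) : |innerAt β' x μ - innerAt β x μ| ≤ dist μ x * (K * dist β' β) := by
  rcases eq_or_ne μ x with rfl | hx
  · simp only [innerAt, dist_self, zero_mul, sub_self, abs_zero, le_refl]
  rw [innerAt_eq_dist_mul_unitInnerAt, innerAt_eq_dist_mul_unitInnerAt, ← mul_sub, abs_mul,
    abs_of_nonneg dist_nonneg]
  gcongr
  exact H.abs_unitInnerAt_sub_le hgeo hx β' β

/-- Since `innerAt` is symmetric in its parameter `β` and its covariate, a change of the covariate
can be treated as a change of the parameter. -/
lemma mul_abs_unitInnerAt_sub_le (H : HingeComparison M sn K) (hgeo : IsUniquelyGeodesic M)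
    (hγ : IsGeodesic γ μ x) {s : ℝ} (hs : s ∈ Set.Icc 0 (dist μ x)) (hy : 0 < dist m (γ s))
    (hnear : 2 * dist μ m ≤ dist m (γ s)) (hfar : dist m (γ s) ≤ dist m x) (β : M) :
    dist m (γ s) * |unitInnerAt β (γ s) m - unitInnerAt β x m| ≤
      dist m β * (K * (4 * dist μ m)) := by
  have hK := zero_le_one.trans H.one_le
  have hη := hgeo.isGeodesic_geod m x
  set r := dist m (γ s)
  have hmr : dist m (geod m x r) = r := hη.dist_left ⟨hy.le, hfar⟩
  calc r * |unitInnerAt β (γ s) m - unitInnerAt β x m|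
    _ = |innerAt (γ s) β m - innerAt (geod m x r) β m| := by
      rw [innerAt_comm (γ s), innerAt_comm (geod m x r), innerAt_eq_dist_mul_unitInnerAt,
        innerAt_eq_dist_mul_unitInnerAt, hmr, ← mul_sub, abs_mul, abs_of_nonneg dist_nonneg,
        hgeo.unitInnerAt_apply hη ⟨hy, hfar⟩]
    _ ≤ dist m β * (K * dist (γ s) (geod m x r)) := H.abs_innerAt_sub_le hgeo _ _ β m
    _ ≤ dist m β * (K * (4 * dist μ m)) := by
      gcongr
      exact H.dist_apply_le_four_mul hγ hη hs hnear hfar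

lemma abs_unitInnerAt_sub_le_of_sphere (H : HingeComparison M sn K)
    (hgeo : IsUniquelyGeodesic M) {C r : ℝ} (hr : 0 < r)
    (hsphere : ∀ y, dist y m = r → y ≠ μ →
      |unitInnerAt β y μ - unitInnerAt β y m| ≤ C * dist μ m)
    (hμ : 2 * dist μ m ≤ r) (hx : r ≤ dist x m) :
    |unitInnerAt β x μ - unitInnerAt β x m| ≤ (C + dist m β * K * 4 / r) * dist μ m := by
  have hγ := hgeo.isGeodesic_geod μ x
  obtain ⟨s, hs, hys⟩ := hγ.exists_dist_eq (m := m)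
    ⟨by linarith [dist_nonneg (x := μ) (y := m)], hx⟩
  have hμy : geod μ x s ≠ μ := fun h => by rw [h] at hys; linarith
  have hs_pos : 0 < s := by
    have h := dist_pos.2 hμy.symm
    rwa [hγ.dist_left hs] at h
  have hfar := H.mul_abs_unitInnerAt_sub_le hgeo hγ hs (m := m) (by rwa [dist_comm, hys])
    (by rwa [dist_comm m, hys]) (by rwa [dist_comm m, hys, dist_comm m]) β
  rw [dist_comm m (geod μ x s), hys, mul_comm r, ← le_div_iff₀ hr] at hfar
  calc |unitInnerAt β x μ - unitInnerAt β x m|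
    _ = |unitInnerAt β (geod μ x s) μ - unitInnerAt β x m| := by
      rw [hgeo.unitInnerAt_apply hγ ⟨hs_pos, hs.2⟩]
    _ ≤ |unitInnerAt β (geod μ x s) μ - unitInnerAt β (geod μ x s) m| +
          |unitInnerAt β (geod μ x s) m - unitInnerAt β x m| := abs_sub_le _ _ _
    _ ≤ C * dist μ m + dist m β * (K * (4 * dist μ m)) / r :=
      add_le_add (hsphere _ hys hμy) hfar
    _ = (C + dist m β * K * 4 / r) * dist μ m := by ring

lemma exists_abs_innerAt_sub_innerAt_le (H : HingeComparison M sn K)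
    (hgeo : IsUniquelyGeodesic M) (hreg : IsRegularNear β m) {R : ℝ} (hR : 0 ≤ R) :
    ∃ r C : ℝ, 0 < r ∧ 0 ≤ C ∧ ∀ μ x : M, dist μ m ≤ r → dist x m ≤ R →
      |innerAt β x μ - innerAt β x m| ≤ C * dist μ m := by
  obtain ⟨C₁, C₂, r₁, r₂, hC₁, hC₂, hr₁, hr₁₂, hreg⟩ := hreg
  have hK := H.one_le
  set D := C₁ + dist m β * K * 4 / r₁
  refine ⟨r₁ / 2, C₂ + ((R + r₁) * D + dist m β), by positivity, by positivity,
    fun μ x hμ hx => ?_⟩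
  obtain ⟨hball, hsphere⟩ := hreg μ (Metric.mem_closedBall.2 (by linarith))
  by_cases hx₂ : dist x m ≤ r₂
  · refine (hball x hx₂).trans ?_
    exact mul_le_mul_of_nonneg_right (le_add_of_nonneg_right (by positivity)) dist_nonneg
  have hunit : |unitInnerAt β x μ - unitInnerAt β x m| ≤ D * dist μ m := by
    refine H.abs_unitInnerAt_sub_le_of_sphere hgeo hr₁ (fun y hy hyμ => ?_) (by linarith)
      (by linarith)
    simpa only [unitInnerAt, dist_comm β] using hsphere y hy hyμ
  have hxμ : dist μ x ≤ R + r₁ := by linarith [dist_triangle_right μ x m]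
  calc |innerAt β x μ - innerAt β x m|
    _ ≤ dist μ x * |unitInnerAt β x μ - unitInnerAt β x m| + dist μ m * dist m β :=
      abs_innerAt_sub_innerAt_le β x μ m
    _ ≤ (R + r₁) * (D * dist μ m) + dist μ m * dist m β := by gcongr
    _ = ((R + r₁) * D + dist m β) * dist μ m := by ring
    _ ≤ (C₂ + ((R + r₁) * D + dist m β)) * dist μ m :=
      mul_le_mul_of_nonneg_right (le_add_of_nonneg_left hC₂.le) dist_nonneg

lemma exists_abs_innerAt_sub_le (H : HingeComparison M sn K) (hgeo : IsUniquelyGeodesic M)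
    (hreg : IsRegularNear β m) {R : ℝ} (hR : 0 ≤ R) :
    ∃ r C : ℝ, 0 < r ∧ 0 ≤ C ∧ ∀ β' μ x : M, dist μ m ≤ r → dist x m ≤ R →
      |innerAt β' x μ - innerAt β x m| ≤ C * (dist μ m + dist β' β) := by
  obtain ⟨r, C, hr, hC, hbase⟩ := H.exists_abs_innerAt_sub_innerAt_le hgeo hreg hR
  have hK := zero_le_one.trans H.one_le
  refine ⟨r, C + (R + r) * K, hr, by positivity, fun β' μ x hμ hx => ?_⟩
  have hxμ : dist μ x ≤ R + r := by linarith [dist_triangle_right μ x m]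
  calc |innerAt β' x μ - innerAt β x m|
    _ ≤ |innerAt β' x μ - innerAt β x μ| + |innerAt β x μ - innerAt β x m| := abs_sub_le _ _ _
    _ ≤ (R + r) * (K * dist β' β) + C * dist μ m := by
      refine add_le_add ((H.abs_innerAt_sub_le hgeo β β' x μ).trans ?_) (hbase μ x hμ hx)
      gcongr
    _ ≤ (R + r) * K * (dist μ m + dist β' β) + C * (dist μ m + dist β' β) := by
      rw [← mul_assoc]
      gcongr
      exacts [le_add_of_nonneg_left dist_nonneg, le_add_of_nonneg_right dist_nonneg]
    _ = (C + (R + r) * K) * (dist μ m + dist β' β) := by ring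

end HingeComparison

end Stability

/-! ### Excess risk of plug-in classifiers -/

lemma abs_one_sub_two_mul_sigmoid_le (h : ℝ) : |1 - 2 * Real.sigmoid h| ≤ |h| := by
  have hderiv (x : ℝ) : ‖deriv Real.sigmoid x‖ ≤ 1 / 2 := by
    have hpos := Real.sigmoid_pos x
    have hlt := Real.sigmoid_lt_one x
    rw [Real.deriv_sigmoid, Real.norm_eq_abs, abs_le]
    constructor <;> nlinarith [sq_nonneg (2 * Real.sigmoid x - 1)]
  have hmvt := Convex.norm_image_sub_le_of_norm_deriv_le
    (fun x _ => differentiable_sigmoid.differentiableAt) (fun x _ => hderiv x) convex_univ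
    (Set.mem_univ h) (Set.mem_univ 0)
  rw [Real.sigmoid_zero, zero_sub, norm_neg, Real.norm_eq_abs, Real.norm_eq_abs] at hmvt
  calc |1 - 2 * Real.sigmoid h|
    _ = 2 * |2⁻¹ - Real.sigmoid h| := by rw [← abs_two, ← abs_mul, abs_two]; ring_nf
    _ ≤ |h| := by linarith

lemma half_le_sigmoid_iff {h : ℝ} : 2⁻¹ ≤ Real.sigmoid h ↔ 0 ≤ h := by
  rw [← Real.sigmoid_zero, Real.sigmoid_le_iff]

lemma classifier_eq_one_iff {M : Type*} [MetricSpace M] {β μ x : M} :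
    classifier β μ x = 1 ↔ 0 ≤ innerAt β x μ := by
  unfold classifier
  split_ifs with h <;> simp [h]

lemma abs_innerAt_le_of_classifier_ne {M : Type*} [MetricSpace M] {β β' μ μ' x : M}
    (hne : classifier β' μ' x ≠ classifier β μ x) :
    |innerAt β x μ| ≤ |innerAt β' x μ' - innerAt β x μ| := by
  unfold classifier at hne
  split_ifs at hne with h' h h
  · exact absurd rfl hne
  · rw [abs_of_neg (not_le.1 h), abs_of_nonneg] <;> linarith
  · rw [abs_of_nonneg h, abs_of_neg] <;> linarith
  · exact absurd rfl hne

section Risk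

open scoped symmDiff

variable {Ω : Type*} {m mΩ : MeasurableSpace Ω} {P : Measure Ω} {E F G : Set Ω}

lemma measureReal_symmDiff_eq_add_setIntegral [IsFiniteMeasure P] (hm : m ≤ mΩ)
    (hF : MeasurableSet[m] F) (hE : MeasurableSet E) :
    P.real (F ∆ E) = P.real E + ∫ ω in F, (1 - 2 * (P⟦E | m⟧) ω) ∂P := by
  have hcond : ∫ ω in F, (P⟦E | m⟧) ω ∂P = P.real (F ∩ E) := by
    rw [setIntegral_condExp hm ((integrable_const 1).indicator hE) hF, setIntegral_indicator hE,
      setIntegral_const, smul_eq_mul, mul_one]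
  rw [integral_sub (integrable_const 1) (integrable_condExp.restrict.const_mul 2),
    integral_const_mul, hcond, setIntegral_const, smul_eq_mul, mul_one,
    measureReal_symmDiff_eq (hm F hF) hE]
  have hsplitF := measureReal_inter_add_sdiff (μ := P) (s := F) hE
  have hsplitE := measureReal_inter_add_sdiff (μ := P) (s := E) (hm F hF)
  rw [Set.inter_comm] at hsplitE
  linarith

lemma measureReal_symmDiff_le_add [IsProbabilityMeasure P] (hm : m ≤ mΩ)
    (hF : MeasurableSet[m] F) (hG : MeasurableSet[m] G) (hE : MeasurableSet E) {D : ℝ}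
    (hD₀ : 0 ≤ D) (hD : ∀ᵐ ω ∂P, ω ∈ F ∆ G → |1 - 2 * (P⟦E | m⟧) ω| ≤ D) :
    P.real (F ∆ E) ≤ P.real (G ∆ E) + D := by
  have hint : Integrable (fun ω => 1 - 2 * (P⟦E | m⟧) ω) P :=
    (integrable_const 1).sub (integrable_condExp.const_mul 2)
  have hintF := hint.indicator (hm F hF)
  have hintG := hint.indicator (hm G hG)
  rw [measureReal_symmDiff_eq_add_setIntegral hm hF hE,
    measureReal_symmDiff_eq_add_setIntegral hm hG hE, add_assoc]
  gcongr
  rw [← integral_indicator (hm F hF), ← integral_indicator (hm G hG), ← sub_le_iff_le_add',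
    ← integral_sub hintF hintG]
  calc ∫ ω, F.indicator _ ω - G.indicator _ ω ∂P
    _ ≤ ∫ _, D ∂P := by
      refine integral_mono_ae (hintF.sub hintG) (integrable_const D) ?_
      filter_upwards [hD] with ω hω
      by_cases hωF : ω ∈ F <;> by_cases hωG : ω ∈ G <;>
        simp only [Set.mem_symmDiff, hωF, hωG, Set.indicator_of_mem, Set.indicator_of_notMem,
          not_true_eq_false, not_false_eq_true, and_self, and_false, or_false, or_true, or_self,
          true_imp_iff, false_imp_iff] at hω ⊢
      · rwa [sub_self]
      · linarith [(abs_le.1 hω).2]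
      · linarith [(abs_le.1 hω).1]
      · rwa [sub_self]
    _ = D := by rw [integral_const, probReal_univ, one_smul]

lemma setOf_ne_eq_symmDiff (a b : Ω → Fin 2) :
    {ω | a ω ≠ b ω} = {ω | a ω = 1} ∆ {ω | b ω = 1} := by
  have hfin : ∀ i j : Fin 2, i ≠ j ↔ i = 1 ∧ j ≠ 1 ∨ j = 1 ∧ i ≠ 1 := by decide
  ext ω
  exact hfin (a ω) (b ω)

end Risk

section Logistic

variable {Ω M : Type*} [MeasurableSpace Ω] {P : Measure Ω} [IsProbabilityMeasure P]
  [MetricSpace M] [MeasurableSpace M] {X : Ω → M} {Y : Ω → Fin 2} {β μ : M}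

lemma IsLogisticModel.risk_le_add (hmodel : IsLogisticModel P X Y β μ) (hX : Measurable X)
    (hY : Measurable Y) {f : M → Fin 2} (hf : Measurable f) {D : ℝ} (hD₀ : 0 ≤ D)
    (hD : ∀ᵐ ω ∂P, f (X ω) ≠ classifier β μ (X ω) → |innerAt β (X ω) μ| ≤ D) :
    P.real {ω | f (X ω) ≠ Y ω} ≤ P.real {ω | classifier β μ (X ω) ≠ Y ω} + D := by
  have hp : ∀ᵐ ω ∂P, (P⟦{ω | Y ω = 1} | MeasurableSpace.comap X inferInstance⟧) ω =
      Real.sigmoid (innerAt β (X ω) μ) := hmodel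
  have hE : MeasurableSet {ω | Y ω = 1} := hY (measurableSet_singleton 1)
  have hF : MeasurableSet[MeasurableSpace.comap X inferInstance] {ω | f (X ω) = 1} :=
    ⟨f ⁻¹' {1}, hf (measurableSet_singleton 1), rfl⟩
  set p := P⟦{ω | Y ω = 1} | MeasurableSpace.comap X inferInstance⟧
  have hG : MeasurableSet[MeasurableSpace.comap X inferInstance] {ω | 2⁻¹ ≤ p ω} :=
    stronglyMeasurable_condExp.measurable measurableSet_Ici
  have hbayes : {ω | classifier β μ (X ω) = 1} =ᵐ[P] {ω | 2⁻¹ ≤ p ω} := by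
    filter_upwards [hp] with ω hω
    refine propext (classifier_eq_one_iff.trans ?_)
    rw [← half_le_sigmoid_iff, ← hω]
    rfl
  rw [setOf_ne_eq_symmDiff, setOf_ne_eq_symmDiff,
    measureReal_congr (hbayes.symmDiff (EventuallyEq.refl (ae P) {ω | Y ω = 1}))]
  refine measureReal_symmDiff_le_add hX.comap_le hF hG hE hD₀ ?_
  filter_upwards [hp, hbayes.mem_iff, hD] with ω hpω hbayesω hDω hω
  refine (congrArg (fun t => |1 - 2 * t|) hpω).trans_le
    ((abs_one_sub_two_mul_sigmoid_le _).trans (hDω fun heq => ?_))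
  have hiff : f (X ω) = 1 ↔ 2⁻¹ ≤ p ω := by rwa [heq]
  exact (Set.mem_symmDiff.1 hω).elim (fun h => h.2 (hiff.1 h.1)) fun h => h.2 (hiff.2 h.1)

lemma HingeComparison.exists_risk_classifier_le {sn : ℝ → ℝ} {K : ℝ}
    (H : HingeComparison M sn K) (hgeo : IsUniquelyGeodesic M) (hX : Measurable X)
    (hY : Measurable Y) (hsupp : ∃ B : Set M, Bornology.IsBounded B ∧ ∀ᵐ ω ∂P, X ω ∈ B)
    (hmodel : IsLogisticModel P X Y β μ) (hreg : IsRegularNear β μ) :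
    ∃ C : ℝ, 0 < C ∧ ∀ β' μ' : M, Measurable (classifier β' μ') →
      P.real {ω | classifier β' μ' (X ω) ≠ Y ω} ≤
        P.real {ω | classifier β μ (X ω) ≠ Y ω} + C * (dist μ μ' + dist β β') := by
  obtain ⟨B, hB, hXB⟩ := hsupp
  obtain ⟨R, hR, hBR⟩ := hB.subset_closedBall_lt 0 μ
  obtain ⟨r, C, hr, hC, hinner⟩ := H.exists_abs_innerAt_sub_le hgeo hreg hR.le
  refine ⟨C + 1 / r, by positivity, fun β' μ' hmeas => ?_⟩
  rw [dist_comm μ, dist_comm β]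
  rcases le_or_gt (dist μ' μ) r with hμ | hμ
  · refine (hmodel.risk_le_add hX hY hmeas (D := C * (dist μ' μ + dist β' β)) (by positivity)
      ?_).trans ?_
    · filter_upwards [hXB] with ω hω hne
      exact (abs_innerAt_le_of_classifier_ne hne).trans (hinner β' μ' (X ω) hμ (hBR hω))
    · gcongr
      exact le_add_of_nonneg_right (by positivity)
  · calc P.real {ω | classifier β' μ' (X ω) ≠ Y ω}
      _ ≤ 1 := measureReal_le_one
      _ ≤ 1 / r * dist μ' μ := by rw [one_div_mul_eq_div, one_le_div hr]; exact hμ.le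
      _ ≤ (C + 1 / r) * (dist μ' μ + dist β' β) := by
        gcongr
        exacts [le_add_of_nonneg_left hC, le_add_of_nonneg_right dist_nonneg]
      _ ≤ _ := le_add_of_nonneg_left measureReal_nonneg

end Logistic

section Averaging

variable {Ω : Type*} [MeasurableSpace Ω] {P : Measure Ω} [IsProbabilityMeasure P]

lemma measure_prodMk_mem_eq_lintegral {𝒵 𝒲 : Type*} [MeasurableSpace 𝒵] [MeasurableSpace 𝒲]
    {Z : Ω → 𝒵} {W : Ω → 𝒲} (hZ : AEMeasurable Z P)
    (hW : Measurable W) (hindep : IndepFun Z W P) {T : Set (𝒵 × 𝒲)} (hT : MeasurableSet T) :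
    P {ω | (Z ω, W ω) ∈ T} = ∫⁻ ω, P {ω' | (Z ω, W ω') ∈ T} ∂P := by
  have hW' := hW.aemeasurable (μ := P)
  have := Measure.isProbabilityMeasure_map hW'
  calc P {ω | (Z ω, W ω) ∈ T}
    _ = P.map (fun ω => (Z ω, W ω)) T :=
      (Measure.map_apply_of_aemeasurable (hZ.prodMk hW') hT).symm
    _ = ∫⁻ ω, P.map W (Prod.mk (Z ω) ⁻¹' T) ∂P := by
      rw [(indepFun_iff_map_prod_eq_prod_map_map hZ hW').1 hindep, Measure.prod_apply hT,
        lintegral_map' (measurable_measure_prodMk_left hT).aemeasurable hZ]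
    _ = ∫⁻ ω, P {ω' | (Z ω, W ω') ∈ T} ∂P := by
      simp only [Measure.map_apply hW (measurable_prodMk_left hT)]
      rfl

lemma lintegral_le_rpow_lintegral_sq {f : Ω → ℝ≥0∞} (hf : AEMeasurable f P) :
    ∫⁻ ω, f ω ∂P ≤ (∫⁻ ω, f ω ^ 2 ∂P) ^ (1 / 2 : ℝ) := by
  have hholder := ENNReal.lintegral_mul_le_Lp_mul_Lq P Real.HolderConjugate.two_two hf
    (aemeasurable_const (b := (1 : ℝ≥0∞)))
  simpa using hholder

lemma lintegral_add_le_two_mul_rpow {f g : Ω → ℝ≥0∞}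
    (hf : AEMeasurable f P) (hg : AEMeasurable g P) :
    ∫⁻ ω, (f ω + g ω) ∂P ≤
      2 * (∫⁻ ω, f ω ^ 2 ∂P + ∫⁻ ω, g ω ^ 2 ∂P) ^ (1 / 2 : ℝ) := by
  rw [lintegral_add_left' hf, two_mul]
  refine add_le_add ((lintegral_le_rpow_lintegral_sq hf).trans ?_)
    ((lintegral_le_rpow_lintegral_sq hg).trans ?_)
  · exact ENNReal.rpow_le_rpow le_self_add (by positivity)
  · exact ENNReal.rpow_le_rpow le_add_self (by positivity)

variable {M 𝒵 : Type*} [MeasurableSpace M] [MeasurableSpace 𝒵]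

lemma ofReal_excessRisk_le_lintegral {X : Ω → M} {Y : Ω → Fin 2} (hX : Measurable X)
    (hY : Measurable Y) {Z : Ω → 𝒵} (hZ : AEMeasurable Z P)
    (hindep : IndepFun Z (fun ω => (X ω, Y ω)) P) {s₀ : M → Fin 2} {s : 𝒵 → M → Fin 2}
    (hs : Measurable fun w : 𝒵 × M => s w.1 w.2) {e : 𝒵 → ℝ≥0∞}
    (he : ∀ z, P {ω | s z (X ω) ≠ Y ω} ≤ P {ω | s₀ (X ω) ≠ Y ω} + e z) :
    ENNReal.ofReal (excessRisk P X Y s₀ fun ω => s (Z ω)) ≤ ∫⁻ ω, e (Z ω) ∂P := by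
  have hmeas : Measurable fun w : 𝒵 × M × Fin 2 => s w.1 w.2.1 :=
    hs.comp (measurable_fst.prodMk measurable_snd.fst)
  rw [excessRisk, ENNReal.ofReal_sub _ measureReal_nonneg, ofReal_measureReal,
    ofReal_measureReal, tsub_le_iff_left]
  calc P {ω | s (Z ω) (X ω) ≠ Y ω}
    _ = ∫⁻ ω, P {ω' | s (Z ω) (X ω') ≠ Y ω'} ∂P :=
      measure_prodMk_mem_eq_lintegral hZ (hX.prodMk hY) hindep
        (T := {w | s w.1 w.2.1 ≠ w.2.2}) (measurableSet_eq_fun hmeas measurable_snd.snd).compl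
    _ ≤ ∫⁻ ω, (P {ω' | s₀ (X ω') ≠ Y ω'} + e (Z ω)) ∂P := lintegral_mono fun ω => he (Z ω)
    _ = P {ω | s₀ (X ω) ≠ Y ω} + ∫⁻ ω, e (Z ω) ∂P := by
      rw [lintegral_add_left measurable_const, lintegral_const, measure_univ, mul_one]

end Averaging

end AlexandrovLogit

theorem mainTheorem6_general
    {M : Type*} [MetricSpace M] [MeasurableSpace M] [OpensMeasurableSpace M]
    {κ : ℝ} (hgeo : IsUniquelyGeodesic M) (hcurv : CurvatureLE M κ)
    (hdiam : Metric.ediam (Set.univ : Set M) ≤ modelDiam κ / 2)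
    {Ω : Type*} [MeasurableSpace Ω] {P : Measure Ω} [IsProbabilityMeasure P]
    {X : Ω → M} {Y : Ω → Fin 2} (hX : Measurable X) (hY : Measurable Y)
    {μ β : M} (hsupp : ∃ B : Set M, Bornology.IsBounded B ∧ ∀ᵐ ω ∂P, X ω ∈ B)
    (hmodel : IsLogisticModel P X Y β μ) (hreg : IsRegularNear β μ) :
    ∃ c : ℝ, 0 < c ∧
      ∀ {𝒵 : Type*} [MeasurableSpace 𝒵] (Z : Ω → 𝒵) (μhat βhat : 𝒵 → M),
        AEMeasurable Z P → IndepFun Z (fun ω => (X ω, Y ω)) P →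
        Measurable μhat → Measurable βhat →
        (Measurable fun w : 𝒵 × M => classifier (βhat w.1) (μhat w.1) w.2) →
        ENNReal.ofReal (excessRisk P X Y (classifier β μ)
            (fun ω => classifier (βhat (Z ω)) (μhat (Z ω)))) ≤
          ENNReal.ofReal c *
            (∫⁻ ω, edist μ (μhat (Z ω)) ^ 2 ∂P +
              ∫⁻ ω, edist β (βhat (Z ω)) ^ 2 ∂P) ^ (1 / 2 : ℝ) := by
  obtain ⟨sn, K, H⟩ := exists_hingeComparison hgeo hcurv hdiam
  obtain ⟨C, hC, hrisk⟩ := H.exists_risk_classifier_le hgeo hX hY hsupp hmodel hreg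
  refine ⟨C * 2, by positivity, fun Z μhat βhat hZ hindep hμhat hβhat hclass => ?_⟩
  have hμZ : AEMeasurable (fun ω => edist μ (μhat (Z ω))) P :=
    measurable_edist_right.comp_aemeasurable (hμhat.comp_aemeasurable hZ)
  have hβZ : AEMeasurable (fun ω => edist β (βhat (Z ω))) P :=
    measurable_edist_right.comp_aemeasurable (hβhat.comp_aemeasurable hZ)
  have hfixed (z) : P {ω | classifier (βhat z) (μhat z) (X ω) ≠ Y ω} ≤
      P {ω | classifier β μ (X ω) ≠ Y ω} +
        ENNReal.ofReal C * (edist μ (μhat z) + edist β (βhat z)) := by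
    have hz := ENNReal.ofReal_le_ofReal
      (hrisk (βhat z) (μhat z) (hclass.comp measurable_prodMk_left))
    rwa [ENNReal.ofReal_add measureReal_nonneg (by positivity), ofReal_measureReal,
      ofReal_measureReal, ENNReal.ofReal_mul hC.le,
      ENNReal.ofReal_add dist_nonneg dist_nonneg, ← edist_dist, ← edist_dist] at hz
  refine (ofReal_excessRisk_le_lintegral (s := fun z => classifier (βhat z) (μhat z)) hX hY hZ
    hindep hclass hfixed).trans ?_
  rw [lintegral_const_mul' _ _ ENNReal.ofReal_ne_top, ENNReal.ofReal_mul hC.le,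
    ENNReal.ofReal_ofNat, mul_assoc]
  gcongr
  exact lintegral_add_le_two_mul_rpow hμZ hβZ

theorem mainTheorem6
    {M : Type*} [MetricSpace M] [CompleteSpace M] [MeasurableSpace M] [BorelSpace M]
    (κ : ℝ) (hgeo : IsUniquelyGeodesic M) (hcurv : CurvatureLE M κ)
    (hdiam : Metric.ediam (Set.univ : Set M) ≤ modelDiam κ / 2)
    {Ω : Type*} [MeasurableSpace Ω] (P : Measure Ω) [IsProbabilityMeasure P]
    -- the pair to be classified and the model
    (X : Ω → M) (Y : Ω → Fin 2) (hX : Measurable X) (hY : Measurable Y)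
    (μs βs : M) (hsupp : ∃ B : Set M, Bornology.IsBounded B ∧ ∀ᵐ ω ∂P, X ω ∈ B)
    (hμs : IsFrechetMean P X μs) (hmodel : IsLogisticModel P X Y βs μs)
    (hreg : IsRegularNear βs μs)
    -- the sample: i.i.d. copies of the pair, independent of it
    (Xs : ℕ → Ω → M) (Ys : ℕ → Ω → Fin 2)
    (hident : ∀ i, IdentDistrib (fun ω => (Xs i ω, Ys i ω)) (fun ω => (X ω, Y ω)) P P)
    (hindep : iIndepFun (fun i ω => (Xs i ω, Ys i ω)) P)
    (hnew : IndepFun (fun ω => (X ω, Y ω)) (fun ω i => (Xs i ω, Ys i ω)) P) :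
    ∃ c : ℝ, 0 < c ∧
      ∀ (n : ℕ) (_ : 1 ≤ n)
        -- the estimators, as measurable functions of the sample of size `n`
        (μhat : (Fin n → M) → M) (βhat : (Fin n → M × Fin 2) → M)
        (_ : Measurable μhat) (_ : Measurable βhat)
        (_ : ∀ᵐ ω ∂P, IsSampleFrechetMean (fun i : Fin n => Xs i ω)
          (μhat fun i : Fin n => Xs i ω))
        (_ : ∀ᵐ ω ∂P, ∀ β : M,
          logLik (fun i : Fin n => (Xs i ω, Ys i ω)) (μhat fun i : Fin n => Xs i ω) β ≤
            logLik (fun i : Fin n => (Xs i ω, Ys i ω)) (μhat fun i : Fin n => Xs i ω)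
              (βhat fun i : Fin n => (Xs i ω, Ys i ω)))
        -- the plug-in classifier is a measurable function of the sample and the covariate
        (_ : Measurable fun z : (Fin n → M × Fin 2) × M =>
          classifier (βhat z.1) (μhat fun i => (z.1 i).1) z.2),
        ENNReal.ofReal (excessRisk P X Y (classifier βs μs)
            (fun ω => classifier (βhat fun i : Fin n => (Xs i ω, Ys i ω))
              (μhat fun i : Fin n => Xs i ω))) ≤
          ENNReal.ofReal c *
            (∫⁻ ω, edist μs (μhat fun i : Fin n => Xs i ω) ^ 2 ∂P +
              ∫⁻ ω, edist βs (βhat fun i : Fin n => (Xs i ω, Ys i ω)) ^ 2 ∂P) ^ (1 / 2 : ℝ) := by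
  obtain ⟨c, hc, hbound⟩ := mainTheorem6_general hgeo hcurv hdiam hX hY hsupp hmodel hreg
  refine ⟨c, hc, fun n _ μhat βhat hμhat hβhat _ _ hclass => ?_⟩
  have hsample : Measurable fun (z : ℕ → M × Fin 2) (i : Fin n) => z i :=
    measurable_pi_lambda _ fun i => measurable_pi_apply _
  exact hbound (fun ω (i : Fin n) => (Xs i ω, Ys i ω)) (fun z => μhat fun i => (z i).1) βhat
    (aemeasurable_pi_iff.2 fun i => (hident i).aemeasurable_fst)
    (hnew.comp measurable_id hsample).symm
    (hμhat.comp (measurable_pi_lambda _ fun i => (measurable_pi_apply i).fst)) hβhat hclass
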